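/- Let $n>3$. For $x=(x_1,\dots,x_n)\in\mathbb R^n$ put $z=(x_2,\dots,x_n)$ and consider the chained-form system $$\dot x_1=u,\qquad \dot x_i=u\,x_{i+1}\ \ (2\le i\le n-1),\qquad \dot x_n=v$$ in closed loop with $$u(t,x)=-k_1x_1+h(t,z),\qquad v(t,x)=-k_n'x_n-k_{n-1}'\,u(t,x)\,x_{n-1}-k_{n-2}'x_{n-2}-k_{n-3}'\,u(t,x)\,x_{n-3}-\cdots,$$ where $k_1>0$, $k_2',\dots,k_n'>0$ and the sum ends with the term in $x_2$ (the factor $u$ is present exactly in the terms $x_i$ with $n-i$ odd). Define new coordinates recursively by $\bar x_2=x_2$, $\bar x_3=x_3$, $v_3=-k_2u\bar x_2-k_3\bar x_3$ and, for $3<i\le n$, $$\bar x_i=x_i-\frac{\partial v_{i-1}}{\partial u},\qquad v_i=\frac{d}{dt}\Big(\frac{\partial v_{i-1}}{\partial u}\Big)-k_{i-1}u\,\bar x_{i-1}-k_i\bar x_i ,$$ where $d/dt$ is taken along $\dot x_j=u\,x_{j+1}$; each $v_i$ is regarded as a function of $u$ and $x$, and $\bar x=(\bar x_2,\dots,\bar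 x_n)$ is an invertible linear function of $z$ with constant coefficients. Suppose that the gains $k_i'$ are such that $v=v_n$ for positive constants $k_2,\dots,k_n$. Then in the coordinates $(x_1,\bar x)$ the closed-loop system has the skew-symmetric form $$\dot x_1=-k_1x_1+h(t,z)=u,\qquad \dot{\bar x}=A(u)\,\bar x, \tag{S}$$ where $A(u)$ is the tridiagonal $(n-1)\times(n-1)$ matrix with all entries above the diagonal equal to $u$, entries $-k_2u,\dots,-k_{n-1}u$ below the diagonal, and diagonal $(0,\dots,0,-k_n)$. Assume that $h$ is twice continuously differentiable, that $h(t,0)=0$ for all $t\in\mathbb R$, and that all first and second partial derivatives of $h$ at $(t,z)$ are bounded in absolute value by $\rho(|z|)$ with $\rho$ nondecreasing. For $\xi\in\mathbb R^{n-2}$ let $\varphi(t,\xi)=\frac{\partial h}{\partial t}(t,z)$, where $z$ is the point with coordinates $\bar x=(\xi,0)$, and assume that $\varphi$ is uniformly $\delta$-persistently exciting: for each $\xi\neq0$ there are $\delta,T,\mu>0$ such that $\int_t^{t+T}|\varphi(\tau,\eta)|\,d\tau\ge\mu$ for all $t\in\mathbb R$ and all $\eta$ with $|\eta-\xi|\le\delta$.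 Then the origin of (S) is uniformly globally asymptotically stable: all solutions exist for all forward times; there is a continuous strictly increasing unbounded $\gamma:[0,\infty)\to[0,\infty)$ with $\gamma(0)=0$ such that every solution $X=(x_1,\bar x)$ satisfies $|X(t)|\le\gamma(|X(t_0)|)$ for all $t_0\in\mathbb R$ and $t\ge t_0$; and for all $r,\sigma>0$ there is $T>0$ such that, for all $t_0\in\mathbb R$, $|X(t_0)|\le r$ implies $|X(t)|\le\sigma$ for all $t\ge t_0+T$. -/

import Mathlib

open Set Filter Topology MeasureTheory

noncomputable section

namespace ChainedForm

/-- `ℝ^d` with the Euclidean norm. -/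
abbrev Vec (d : ℕ) : Type := EuclideanSpace ℝ (Fin d)

section Stability

variable {E : Type*} [NormedAddCommGroup E] [NormedSpace ℝ E]

/-- Comparison functions of class `K_∞`, as functions on `[0, ∞)`. -/
def IsClassKInfty (γ : ℝ → ℝ) : Prop :=
  ContinuousOn γ (Ici 0) ∧ StrictMonoOn γ (Ici 0) ∧ γ 0 = 0 ∧ Tendsto γ atTop atTop

/-- Forward completeness of `x' = f(t,x)`: every initial condition has a solution on `[t₀, ∞)`, and
every solution on an interval `[t₀, b)` is the restriction of a solution on `[t₀, ∞)`. -/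
def IsForwardComplete (f : ℝ → E → E) : Prop :=
  (∀ (t₀ : ℝ) (x₀ : E), ∃ x : ℝ → E, x t₀ = x₀ ∧ IsIntegralCurveOn x f (Ici t₀)) ∧
  ∀ (t₀ b : ℝ) (x : ℝ → E), IsIntegralCurveOn x f (Ico t₀ b) →
    ∃ y : ℝ → E, IsIntegralCurveOn y f (Ici t₀) ∧ EqOn x y (Ico t₀ b)

/-- Uniform global stability of the origin of `x' = f(t,x)`. -/
def IsUGS (f : ℝ → E → E) : Prop :=
  ∃ γ : ℝ → ℝ, IsClassKInfty γ ∧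
    ∀ (t₀ : ℝ) (x : ℝ → E), IsIntegralCurveOn x f (Ici t₀) →
      ∀ t, t₀ ≤ t → ‖x t‖ ≤ γ ‖x t₀‖

/-- Uniform global attractivity of the origin of `x' = f(t,x)`. -/
def IsUGA (f : ℝ → E → E) : Prop :=
  ∀ r : ℝ, 0 < r → ∀ σ : ℝ, 0 < σ → ∃ T : ℝ, 0 < T ∧
    ∀ (t₀ : ℝ) (x : ℝ → E), IsIntegralCurveOn x f (Ici t₀) → ‖x t₀‖ ≤ r →
      ∀ t, t₀ + T ≤ t → ‖x t‖ ≤ σ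

/-- Uniform global asymptotic stability of the origin of `x' = f(t,x)`; the solutions are in
particular defined for all forward times. -/
def IsUGAS (f : ℝ → E → E) : Prop :=
  IsForwardComplete f ∧ IsUGS f ∧ IsUGA f

/-- Uniform `δ`-persistency of excitation of `φ(t,ξ)` with respect to (the whole of) `ξ`. -/
def IsUDeltaPE {F : Type*} [NormedAddCommGroup F] (φ : ℝ → E → F) : Prop :=
  (∀ ξ : E, LocallyIntegrable (fun t => φ t ξ)) ∧
  ∀ ξ : E, ξ ≠ 0 → ∃ δ > (0 : ℝ), ∃ T > (0 : ℝ), ∃ μ > (0 : ℝ),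
    ∀ (t : ℝ) (η : E), ‖η - ξ‖ ≤ δ → μ ≤ ∫ τ in t..(t + T), ‖φ τ η‖

end Stability

/-! Throughout, the number of states is `n = p + 2`. The state `x = (x_1, …, x_n)` is `x : Vec (p+2)`
with `x_i` the entry of index `i - 1`; the vector `z = (x_2, …, x_n)` is in `Vec (p+1)`, with `x_i`
the entry of index `i - 2`. Gains `k : ℕ → ℝ` carry the indices of the mathematical text
(`k i` is `k_i`). -/

section Chained

variable {p : ℕ}

/-- `z = (x_2, …, x_n)`. -/
def tail (x : Vec (p + 2)) : Vec (p + 1) := WithLp.toLp 2 (fun j => x j.succ)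

/-- The vector `(y, z)`. -/
def pair (y : ℝ) (z : Vec (p + 1)) : Vec (p + 2) := WithLp.toLp 2 (Fin.cons y z.ofLp)

/-- The vector `(ξ, 0)`. -/
def extendZero (ξ : Vec p) : Vec (p + 1) := WithLp.toLp 2 (Fin.snoc ξ.ofLp 0)

/-- The chained-form system with feedbacks `u`, `v`:
`x_1' = u`, `x_i' = u x_{i+1}` for `2 ≤ i ≤ n - 1`, `x_n' = v`. -/
def chainedField (u v : ℝ → Vec (p + 2) → ℝ) (t : ℝ) (x : Vec (p + 2)) : Vec (p + 2) :=
  WithLp.toLp 2 (fun i : Fin (p + 2) =>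
    if (i : ℕ) = 0 then u t x
    else if hi : (i : ℕ) + 1 < p + 2 then u t x * x ⟨(i : ℕ) + 1, hi⟩
    else v t x)

/-- The control `u(t,x) = -k_1 x_1 + h(t,z)`. -/
def controlU (k₁ : ℝ) (h : ℝ → Vec (p + 1) → ℝ) (t : ℝ) (x : Vec (p + 2)) : ℝ :=
  -k₁ * x 0 + h t (tail x)

/-- `-k'_n x_n - k'_{n-1} u x_{n-1} - k'_{n-2} x_{n-2} - k'_{n-3} u x_{n-3} - ⋯ `, down to the term
in `x_2`, as a function of the number `u` and of `z = (x_2, …, x_n)`. -/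
def alternatingFeedback (k' : ℕ → ℝ) (u : ℝ) (z : Vec (p + 1)) : ℝ :=
  -∑ j : Fin (p + 1), k' ((j : ℕ) + 2) * (if Even (p - (j : ℕ)) then 1 else u) * z j

/-- The control `v(t,x)`. -/
def controlV (k₁ : ℝ) (k' : ℕ → ℝ) (h : ℝ → Vec (p + 1) → ℝ) (t : ℝ) (x : Vec (p + 2)) : ℝ :=
  alternatingFeedback k' (controlU k₁ h t x) (tail x)

/-- The chained-form system in closed loop with the alternating controls. -/
def chainedClosedLoop (k₁ : ℝ) (k' : ℕ → ℝ) (h : ℝ → Vec (p + 1) → ℝ) :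
    ℝ → Vec (p + 2) → Vec (p + 2) :=
  chainedField (controlU k₁ h) (controlV k₁ k' h)

end Chained

/-! The change of coordinates to the skew-symmetric form. A linear form `∑_j c_j x_j` in the states is
represented by its coefficient sequence `c : ℕ → ℝ`. -/

/-- Along `x_j' = u x_{j+1}`, the time derivative of the form `c` is `u` times the form
`shift c`. -/
def shift (c : ℕ → ℝ) : ℕ → ℝ
  | 0 => 0
  | j + 1 => c j

/-- The pair of linear forms `(x̄_i, ∂v_i/∂u)` for `i = m + 2`, where `v_i = u ∂v_i/∂u - k_i x̄_i`:
`x̄_2 = x_2`, `∂v_2/∂u = 0`, `x̄_{i+1} = x_{i+1} - ∂v_i/∂u` and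
`v_{i+1} = d/dt (∂v_i/∂u) - k_i u x̄_i - k_{i+1} x̄_{i+1}`.
In particular `x̄_3 = x_3` and `v_3 = -k_2 u x̄_2 - k_3 x̄_3`. -/
def skewRec (k : ℕ → ℝ) : ℕ → (ℕ → ℝ) × (ℕ → ℝ)
  | 0 => (Pi.single 2 1, 0)
  | m + 1 =>
    (Pi.single (m + 3) 1 - (skewRec k m).2,
      shift (skewRec k m).2 - k (m + 2) • (skewRec k m).1)

section Skew

variable {p : ℕ}

/-- The form with coefficients `c`, evaluated at `z = (x_2, …, x_n)`. -/
def evalForm (c : ℕ → ℝ) (z : Vec (p + 1)) : ℝ := ∑ j : Fin (p + 1), c ((j : ℕ) + 2) * z j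

/-- The feedback `v_n = u ∂v_n/∂u - k_n x̄_n` given by the last step of the recursion. -/
def recursiveFeedback (k : ℕ → ℝ) (u : ℝ) (z : Vec (p + 1)) : ℝ :=
  u * evalForm (skewRec k p).2 z - k (p + 2) * evalForm (skewRec k p).1 z

/-- The positive gains `k_2, …, k_n` of the skew-symmetric form are those for which `v = v_n`. -/
def GainsMatch (p : ℕ) (k' k : ℕ → ℝ) : Prop :=
  ∀ (u : ℝ) (z : Vec (p + 1)), alternatingFeedback k' u z = recursiveFeedback k u z

/-- The matrix of `(x_2, …, x_n) ↦ (x̄_2, …, x̄_n)`. -/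
def skewMatrix (p : ℕ) (k : ℕ → ℝ) : Matrix (Fin (p + 1)) (Fin (p + 1)) ℝ :=
  Matrix.of fun i j => (skewRec k (i : ℕ)).1 ((j : ℕ) + 2)

/-- `(x̄_2, …, x̄_n)` as a function of `(x_2, …, x_n)`. -/
def toSkew (k : ℕ → ℝ) (z : Vec (p + 1)) : Vec (p + 1) :=
  WithLp.toLp 2 ((skewMatrix p k).mulVec z.ofLp)

/-- `(x_2, …, x_n)` as a function of `(x̄_2, …, x̄_n)`. -/
def ofSkew (k : ℕ → ℝ) (zbar : Vec (p + 1)) : Vec (p + 1) :=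
  WithLp.toLp 2 ((skewMatrix p k)⁻¹.mulVec zbar.ofLp)

lemma skewRec_support (k : ℕ → ℝ) (m : ℕ) :
    (∀ j, m + 2 < j → (skewRec k m).1 j = 0) ∧ (∀ j, m + 2 ≤ j → (skewRec k m).2 j = 0) := by
  induction m with
  | zero =>
    refine ⟨fun j hj => ?_, fun j _ => rfl⟩
    simp only [skewRec]
    exact Pi.single_eq_of_ne (by omega) _
  | succ m ih =>
    refine ⟨fun j hj => ?_, fun j hj => ?_⟩
    · have h1 : (Pi.single (m + 3) (1 : ℝ) : ℕ → ℝ) j = 0 := Pi.single_eq_of_ne (by omega) _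
      simp [skewRec, h1, ih.2 j (by omega)]
    · obtain ⟨i, rfl⟩ : ∃ i, j = i + 1 := ⟨j - 1, by omega⟩
      simp [skewRec, shift, ih.2 i (by omega), ih.1 (i + 1) (by omega)]

lemma skewRec_diag (k : ℕ → ℝ) (m : ℕ) : (skewRec k m).1 (m + 2) = 1 := by
  cases m with
  | zero => simp [skewRec]
  | succ m => simp [skewRec, (skewRec_support k m).2 (m + 3) (by omega)]

/-- The change of coordinates is invertible, so that `ofSkew` is the inverse of `toSkew`. -/
lemma det_skewMatrix (k : ℕ → ℝ) : (skewMatrix p k).det = 1 := by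
  have h : (skewMatrix p k).BlockTriangular OrderDual.toDual := by
    intro i j hij
    have : (i : ℕ) < j := hij
    exact (skewRec_support k i).1 _ (by omega)
  rw [Matrix.det_of_isLowerTriangular _ h]
  exact Finset.prod_eq_one fun i _ => skewRec_diag k i

lemma ofSkew_toSkew (k : ℕ → ℝ) (z : Vec (p + 1)) : ofSkew k (toSkew k z) = z := by
  have h : IsUnit (skewMatrix p k).det := by simp [det_skewMatrix]
  simp [ofSkew, toSkew, Matrix.mulVec_mulVec, Matrix.nonsing_inv_mul _ h]

lemma toSkew_ofSkew (k : ℕ → ℝ) (z : Vec (p + 1)) : toSkew k (ofSkew k z) = z := by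
  have h : IsUnit (skewMatrix p k).det := by simp [det_skewMatrix]
  simp [ofSkew, toSkew, Matrix.mulVec_mulVec, Matrix.mul_nonsing_inv _ h]

/-- The full change of coordinates `x = (x_1, x_2, …, x_n) ↦ (x_1, x̄_2, …, x̄_n)`. -/
def skewCoord (k : ℕ → ℝ) (x : Vec (p + 2)) : Vec (p + 2) := pair (x 0) (toSkew k (tail x))

/-- The tridiagonal matrix `A(u)`: entries `u` above the diagonal, `-k_2 u, …, -k_{n-1} u` below the
diagonal, and diagonal `(0, …, 0, -k_n)`. -/
def skewA (p : ℕ) (k : ℕ → ℝ) (u : ℝ) : Matrix (Fin (p + 1)) (Fin (p + 1)) ℝ :=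
  Matrix.of fun i j =>
    if (j : ℕ) = (i : ℕ) + 1 then u
    else if (i : ℕ) = (j : ℕ) + 1 then -k ((j : ℕ) + 2) * u
    else if (i : ℕ) = p ∧ (j : ℕ) = p then -k (p + 2)
    else 0

/-- The function `h` as a function of `t` and of the coordinates `(x̄_2, …, x̄_n)`. -/
def skewH (k : ℕ → ℝ) (h : ℝ → Vec (p + 1) → ℝ) (t : ℝ) (zbar : Vec (p + 1)) : ℝ :=
  h t (ofSkew k zbar)

/-- The closed-loop system in skew-symmetric form, with state `X = (x_1, x̄_2, …, x̄_n)`: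
`x_1' = -k_1 x_1 + h(t,z) = u`, `x̄' = A(u) x̄`. -/
def skewClosedLoop (k : ℕ → ℝ) (h : ℝ → Vec (p + 1) → ℝ) (t : ℝ) (X : Vec (p + 2)) :
    Vec (p + 2) :=
  pair (controlU (k 1) (skewH k h) t X)
    (WithLp.toLp 2 ((skewA p k (controlU (k 1) (skewH k h) t X)).mulVec (tail X).ofLp))

/-- `φ(t,ξ) = ∂/∂t h(t, z)` where `z` is the point with `(x̄_2, …, x̄_n) = (ξ, 0)`. -/
def excitation (k : ℕ → ℝ) (h : ℝ → Vec (p + 1) → ℝ) (t : ℝ) (ξ : Vec p) : ℝ :=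
  deriv (fun s => skewH k h s (extendZero ξ)) t

end Skew

section Bounds

variable {d : ℕ}

/-- The coordinate directions of `ℝ × ℝ^d`: `none` is the direction of `t`, `some i` that of
`z_i`. -/
def coordDir : Option (Fin d) → ℝ × Vec d
  | none => (1, 0)
  | some i => (0, EuclideanSpace.single i 1)

/-- The partial derivative of a function on `ℝ × ℝ^d` with respect to the coordinate `a`. -/
def partialDeriv (a : Option (Fin d)) (H : ℝ × Vec d → ℝ) (q : ℝ × Vec d) : ℝ :=
  lineDeriv ℝ H q (coordDir a)

/-- `h` is twice continuously differentiable in `(t,z)`, and all its first and second partial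
derivatives are bounded, uniformly in `t`, by a nondecreasing function of `‖z‖`. -/
def HasBoundedPartials (h : ℝ → Vec d → ℝ) : Prop :=
  ContDiff ℝ 2 (Function.uncurry h) ∧
  ∃ ρ : ℝ → ℝ, MonotoneOn ρ (Ici 0) ∧
    ∀ (t : ℝ) (z : Vec d),
      (∀ a, |partialDeriv a (Function.uncurry h) (t, z)| ≤ ρ ‖z‖) ∧
      (∀ a b, |partialDeriv a (partialDeriv b (Function.uncurry h)) (t, z)| ≤ ρ ‖z‖)

end Bounds

end ChainedForm

end

open Set Filter Topology MeasureTheory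

noncomputable section

namespace ChainedForm

/-! ### Existence, uniqueness and forward completeness from a priori bounds -/

section ODE

variable {E : Type*} [NormedAddCommGroup E] [NormedSpace ℝ E] [FiniteDimensional ℝ E]
  {f : ℝ → E → E}

/-! Up to a diagonal scaling, `A(u)` is skew-symmetric apart from its damping entry. Hence V = ∑
x̄_i² / (k_2 ⋯ k_{i-1}) has derivative −c x̄_n² with c > 0, whatever u is (`sum_skewRate`). So |x̄|
is at most a constant times any of its earlier values, and x_1 is a stable scalar filter driven by
h, which is itself controlled by |x̄|. This yields the a priori bound `exists_norm_le`, from which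
forward completeness and uniform stability follow.

Attractivity is proved by contradiction. If x̄ could stay at distance at least ε from 0 for
arbitrarily long times, the pigeonhole principle would give windows of one fixed length L on which
the decrease of V tends to zero. On these windows a Barbalat argument that needs no limit trajectory
applies (`Vanishes.of_hasDerivWithinAt`): if F is small and F' = G + E with G uniformly Lipschitz
and E small, then G is small. It is used repeatedly. From the decrease of V one gets x̄_n → 0. From
u² x̄_{i+1} one gets u x̄_i → 0, for i descending from n − 1. Since |x̄| ≥ ε, this forces u → 0, and
then u' = ∂h/∂t + (small) gives ∂h/∂t → 0 along the trajectories.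

The velocity of x̄ also tends to zero, so on a late window x̄ is almost a constant point (ξ, 0). By
the Lipschitz bound on ∂h/∂t, the function φ(·, ξ) is then small on a whole window of length L. This
contradicts persistency of excitation, which compactness makes uniform over shells of ξ
(`BoundedTrajectories.not_persistent`, `IsUDeltaPE.exists_uniform`). Once x̄ is small it stays
small, and x_1 follows exponentially. -/

/-- A `C¹` field multiplied by a bump function is bounded and Lipschitz in the state, uniformly on
compact time intervals. -/
lemma exists_lipschitzWith_bump_smul (hf : ContDiff ℝ 1 (Function.uncurry f))
    (b : ContDiffBump (0 : E)) (t₀ t₁ : ℝ) :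
    ∃ K C : NNReal, ∀ t ∈ Icc t₀ t₁, LipschitzWith K (fun y => b y • f t y) ∧
      ∀ y, ‖b y • f t y‖ ≤ C := by
  set g : ℝ × E → E := fun q => b q.2 • f q.1 q.2 with hg
  have hgc : ContDiff ℝ 1 g := by
    have h1 : ContDiff ℝ 1 (fun q : ℝ × E => b q.2) := b.contDiff.comp contDiff_snd
    exact h1.smul hf
  have hK : IsCompact (Icc t₀ t₁ ×ˢ Metric.closedBall (0 : E) b.rOut) :=
    isCompact_Icc.prod (isCompact_closedBall _ _)
  obtain ⟨K, hKb⟩ := hK.exists_bound_of_continuousOn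
    (hgc.continuous_fderiv (by norm_num)).continuousOn
  obtain ⟨C, hCb⟩ := hK.exists_bound_of_continuousOn hgc.continuous.continuousOn
  have hzero : ∀ y : E, y ∉ Metric.closedBall (0 : E) b.rOut → b y = 0 := fun y hy =>
    b.zero_of_le_dist (not_le.1 hy).le
  refine ⟨K.toNNReal, C.toNNReal, fun t ht => ⟨?_, fun y => ?_⟩⟩
  · have hd : ∀ y, HasFDerivAt (fun y => b y • f t y)
        ((fderiv ℝ g (t, y)).comp (ContinuousLinearMap.inr ℝ ℝ E)) y := fun y => by
      have h1 := ((hgc.differentiable (by norm_num)) (t, y)).hasFDerivAt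
      exact h1.comp y (hasFDerivAt_prodMk_right t y)
    refine lipschitzWith_of_nnnorm_fderiv_le (fun y => (hd y).differentiableAt) fun y => ?_
    rw [← NNReal.coe_le_coe, coe_nnnorm]
    by_cases hy : y ∈ Metric.closedBall (0 : E) b.rOut
    · rw [(hd y).fderiv]
      calc _ ≤ ‖fderiv ℝ g (t, y)‖ * ‖ContinuousLinearMap.inr ℝ ℝ E‖ :=
            ContinuousLinearMap.opNorm_comp_le _ _
        _ ≤ ‖fderiv ℝ g (t, y)‖ * 1 := by
            gcongr
            exact ContinuousLinearMap.norm_inr_le_one ℝ ℝ E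
        _ ≤ K := by rw [mul_one]; exact hKb _ ⟨ht, hy⟩
        _ ≤ _ := Real.le_coe_toNNReal K
    · have : (fun y => b y • f t y) =ᶠ[𝓝 y] fun _ => 0 := by
        filter_upwards [Metric.isClosed_closedBall.isOpen_compl.mem_nhds hy] with w hw
        simp [hzero w hw]
      rw [this.fderiv_eq]
      simp
  · by_cases hy : y ∈ Metric.closedBall (0 : E) b.rOut
    · exact (hCb (t, y) ⟨ht, hy⟩).trans (Real.le_coe_toNNReal C)
    · simp [hzero y hy]

/-- Uniqueness of the solutions of `x' = f(t,x)` for a `C¹` field. -/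
lemma integralCurve_unique (hf : ContDiff ℝ 1 (Function.uncurry f)) {a b : ℝ} {x y : ℝ → E}
    (hx : IsIntegralCurveOn x f (Icc a b)) (hy : IsIntegralCurveOn y f (Icc a b))
    (h0 : x a = y a) : EqOn x y (Icc a b) := by
  obtain ⟨R, hR⟩ := (isCompact_Icc (a := a) (b := b)).exists_bound_of_continuousOn hx.continuousOn
  obtain ⟨S, hS⟩ := (isCompact_Icc (a := a) (b := b)).exists_bound_of_continuousOn hy.continuousOn
  -- The bump equals 1 on a ball containing both curves, so both solve the truncated, globally
  -- Lipschitz equation. The outer `max 1` only makes the radius positive.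
  let β : ContDiffBump (0 : E) :=
    ⟨max 1 (max R S), max 1 (max R S) + 1, by positivity, by linarith⟩
  obtain ⟨K, _, hK⟩ := exists_lipschitzWith_bump_smul hf β a b
  have hβ : ∀ w : E, ‖w‖ ≤ max R S → β w = 1 := fun w hw =>
    β.one_of_mem_closedBall (by simpa [β] using Or.inr (by simpa using hw))
  refine ODE_solution_unique_of_mem_Icc_right (v := fun t w => β w • f t w) (s := fun _ => univ)
    (fun t ht => ((hK t (Ico_subset_Icc_self ht)).1).lipschitzOnWith) hx.continuousOn
    (fun t ht => ?_) (fun _ _ => trivial) hy.continuousOn (fun t ht => ?_) (fun _ _ => trivial) h0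
  · simp only [hβ _ ((hR t (Ico_subset_Icc_self ht)).trans (le_max_left _ _)), one_smul]
    exact (hx t (Ico_subset_Icc_self ht)).mono_of_mem_nhdsWithin (Icc_mem_nhdsGE_of_mem ht)
  · simp only [hβ _ ((hS t (Ico_subset_Icc_self ht)).trans (le_max_right _ _)), one_smul]
    exact (hy t (Ico_subset_Icc_self ht)).mono_of_mem_nhdsWithin (Icc_mem_nhdsGE_of_mem ht)

/-- An a priori bound for the solutions of all fields `χ f` with `0 ≤ χ ≤ 1` gives solutions of
`x' = f(t,x)` on arbitrary compact intervals. -/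
lemma exists_integralCurveOn_Icc (hf : ContDiff ℝ 1 (Function.uncurry f)) (B : E → ℝ)
    (hB : ∀ χ : E → ℝ, Continuous χ → (∀ y, χ y ∈ Icc (0 : ℝ) 1) → ∀ t₀ t₁ : ℝ, t₀ ≤ t₁ →
      ∀ x : ℝ → E, IsIntegralCurveOn x (fun t y => χ y • f t y) (Icc t₀ t₁) →
        ‖x t₁‖ ≤ B (x t₀)) (t₀ t₁ : ℝ) (ht : t₀ ≤ t₁) (x₀ : E) :
    ∃ x : ℝ → E, x t₀ = x₀ ∧ IsIntegralCurveOn x f (Icc t₀ t₁) := by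
  let β : ContDiffBump (0 : E) :=
    ⟨max 1 (B x₀), max 1 (B x₀) + 1, by positivity, by linarith⟩
  obtain ⟨K, C, hK⟩ := exists_lipschitzWith_bump_smul hf β t₀ t₁
  -- The truncated field is bounded by `C` everywhere, so a ball of radius `C * (t₁ - t₀)` cannot be
  -- left and the time interval need not shrink.
  have hpl : IsPicardLindelof (fun t y => β y • f t y) (tmin := t₀) (tmax := t₁)
      ⟨t₀, le_rfl, ht⟩ x₀ (C * (t₁ - t₀).toNNReal) 0 C K :=
    { lipschitzOnWith := fun t h => (hK t h).1.lipschitzOnWith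
      continuousOn := fun y _ => by
        have h1 : Continuous fun t => f t y :=
          hf.continuous.comp (f := fun t : ℝ => (t, y)) (by fun_prop)
        exact (h1.const_smul (β y)).continuousOn
      norm_le := fun t h y _ => (hK t h).2 y
      mul_max_le := by
        have h1 : 0 ≤ t₁ - t₀ := sub_nonneg.2 ht
        simp [h1] }
  obtain ⟨x, hx0, hx⟩ := hpl.exists_eq_forall_mem_Icc_hasDerivWithinAt₀
  refine ⟨x, hx0, fun t h => ?_⟩
  -- The a priori bound with χ = β keeps the truncated solution where β = 1, so it solves the
  -- original equation.
  have hb : ‖x t‖ ≤ B x₀ := by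
    have := hB β β.continuous (fun y => ⟨β.nonneg, β.le_one⟩) t₀ t h.1 x
      (IsIntegralCurveOn.mono (s := Icc t₀ t₁) hx (Icc_subset_Icc_right h.2))
    simpa only [show x t₀ = x₀ from hx0] using this
  have h1 : β (x t) = 1 := β.one_of_mem_closedBall (by simpa [β] using Or.inr hb)
  simpa [h1] using hx t h

/-- An a priori bound for the solutions of all fields `χ f` with `0 ≤ χ ≤ 1` gives forward
completeness of `x' = f(t,x)`. -/
theorem isForwardComplete_of_bound (hf : ContDiff ℝ 1 (Function.uncurry f)) (B : E → ℝ)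
    (hB : ∀ χ : E → ℝ, Continuous χ → (∀ y, χ y ∈ Icc (0 : ℝ) 1) → ∀ t₀ t₁ : ℝ, t₀ ≤ t₁ →
      ∀ x : ℝ → E, IsIntegralCurveOn x (fun t y => χ y • f t y) (Icc t₀ t₁) →
        ‖x t₁‖ ≤ B (x t₀)) : IsForwardComplete f := by
  have hex : ∀ (t₀ : ℝ) (x₀ : E), ∃ x : ℝ → E, x t₀ = x₀ ∧ IsIntegralCurveOn x f (Ici t₀) := by
    intro t₀ x₀
    choose X hX0 hX using fun n : ℕ =>
      exists_integralCurveOn_Icc hf B hB t₀ (t₀ + n) (by simp) x₀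
    have key : ∀ (m n : ℕ) (t : ℝ), t ∈ Icc t₀ (t₀ + m) → t ∈ Icc t₀ (t₀ + n) → X m t = X n t := by
      intro m n t hm hn
      exact integralCurve_unique hf ((hX m).mono (Icc_subset_Icc_right hm.2))
        ((hX n).mono (Icc_subset_Icc_right hn.2)) ((hX0 m).trans (hX0 n).symm) ⟨hm.1, le_rfl⟩
    let N : ℝ → ℕ := fun t => ⌈t - t₀⌉₊
    have hN : ∀ t, t₀ ≤ t → t ∈ Icc t₀ (t₀ + N t) := fun t ht =>
      ⟨ht, by linarith [Nat.le_ceil (t - t₀)]⟩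
    refine ⟨fun t => X (N t) t, hX0 _, fun t ht => ?_⟩
    have ht' : t₀ ≤ t := ht
    -- The extra unit of length makes the interval a neighbourhood of `t` within `Ici t₀`.
    have h1 : t < t₀ + ((N t + 1 : ℕ) : ℝ) := by
      have := (hN t ht').2
      push_cast
      linarith
    have h2 := hX (N t + 1) t ⟨ht', h1.le⟩
    have hmem : Icc t₀ (t₀ + ((N t + 1 : ℕ) : ℝ)) ∈ 𝓝[Ici t₀] t := by
      rw [← Ici_inter_Iic]
      exact inter_mem_nhdsWithin _ (Iic_mem_nhds h1)
    have heq : ∀ s ∈ Icc t₀ (t₀ + ((N t + 1 : ℕ) : ℝ)), X (N s) s = X (N t + 1) s := fun s hs =>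
      key _ _ _ (hN s hs.1) hs
    have h3 := h2.congr (f := X (N t + 1)) heq (heq t ⟨ht', h1.le⟩)
    have h4 := h3.mono_of_mem_nhdsWithin hmem
    rw [← heq t ⟨ht', h1.le⟩] at h4
    exact h4
  refine ⟨hex, fun t₀ b x hx => ?_⟩
  obtain ⟨y, hy0, hy⟩ := hex t₀ (x t₀)
  refine ⟨y, hy, fun t ht => ?_⟩
  exact integralCurve_unique hf (hx.mono fun s hs => ⟨hs.1, hs.2.trans_lt ht.2⟩)
    (hy.mono Icc_subset_Ici_self) hy0.symm ⟨ht.1, le_rfl⟩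

end ODE

/-! ### The conjugation to skew-symmetric form -/

section Coordinates

variable {p : ℕ}

lemma tail_apply (x : Vec (p + 2)) (j : Fin (p + 1)) : tail x j = x j.succ := rfl

@[simp] lemma pair_zero (y : ℝ) (z : Vec (p + 1)) : pair y z 0 = y := rfl

@[simp] lemma pair_succ (y : ℝ) (z : Vec (p + 1)) (j : Fin (p + 1)) : pair y z j.succ = z j := rfl

@[simp] lemma tail_pair (y : ℝ) (z : Vec (p + 1)) : tail (pair y z) = z := rfl

lemma controlU_skewCoord (k : ℕ → ℝ) (k₁ : ℝ) (h : ℝ → Vec (p + 1) → ℝ) (t : ℝ)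
    (x : Vec (p + 2)) :
    controlU k₁ (skewH k h) t (skewCoord k x) = controlU k₁ h t x := by
  simp [controlU, skewCoord, skewH, ofSkew_toSkew]

lemma toSkew_apply (k : ℕ → ℝ) (z : Vec (p + 1)) (i : Fin (p + 1)) :
    toSkew k z i = evalForm (skewRec k i).1 z := rfl

lemma evalForm_add (c d : ℕ → ℝ) (z : Vec (p + 1)) :
    evalForm (c + d) z = evalForm c z + evalForm d z := by
  simp [evalForm, add_mul, Finset.sum_add_distrib]

lemma evalForm_sub (c d : ℕ → ℝ) (z : Vec (p + 1)) :
    evalForm (c - d) z = evalForm c z - evalForm d z := by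
  simp [evalForm, sub_mul, Finset.sum_sub_distrib]

lemma evalForm_smul (a : ℝ) (c : ℕ → ℝ) (z : Vec (p + 1)) :
    evalForm (a • c) z = a * evalForm c z := by
  simp [evalForm, Finset.mul_sum, mul_assoc]

lemma evalForm_zero (z : Vec (p + 1)) : evalForm 0 z = 0 := by simp [evalForm]

lemma evalForm_single_last (z : Vec (p + 1)) :
    evalForm (Pi.single (p + 2) 1) z = z (Fin.last p) := by
  rw [evalForm, Fin.sum_univ_castSucc, Finset.sum_eq_zero, zero_add]
  · simp
  · intro j _
    have : (j : ℕ) + 2 ≠ p + 2 := by omega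
    simp [Pi.single_eq_of_ne this]

/-- `evalForm` reads only indices from 2 on, whereas `shift` moves entry 1 to index 2. Its vanishing
is what makes `shift` represent the time derivative. -/
lemma skewRec_low (k : ℕ → ℝ) (m : ℕ) :
    (∀ j < 2, (skewRec k m).1 j = 0) ∧ (∀ j < 2, (skewRec k m).2 j = 0) := by
  induction m with
  | zero =>
    refine ⟨fun j hj => ?_, fun j _ => rfl⟩
    exact Pi.single_eq_of_ne (by omega) _
  | succ m ih =>
    refine ⟨fun j hj => ?_, fun j hj => ?_⟩
    · have h1 : (Pi.single (m + 3) (1 : ℝ) : ℕ → ℝ) j = 0 := Pi.single_eq_of_ne (by omega) _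
      simp [skewRec, h1, ih.2 j hj]
    · have h2 := ih.1 j hj
      cases j with
      | zero => simp [skewRec, shift, h2]
      | succ i => simp [skewRec, shift, h2, ih.2 i (by omega)]

/-- A form not involving `x_n` is differentiated along `x_j' = u x_{j+1}` by `shift`. -/
lemma evalForm_of_shift {c : ℕ → ℝ} (hc : c (p + 2) = 0) (hc1 : c 1 = 0) {u : ℝ}
    {z w : Vec (p + 1)} (hw : ∀ j : Fin p, w j.castSucc = u * z j.succ) :
    evalForm c w = u * evalForm (shift c) z := by
  rw [evalForm, evalForm, Fin.sum_univ_castSucc, Fin.sum_univ_succ]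
  simp only [Fin.val_castSucc, Fin.val_last, hc, zero_mul, add_zero, hw, Fin.coe_ofNat_eq_mod,
    Nat.zero_mod, zero_add, shift, hc1, Fin.val_succ, Finset.mul_sum]
  refine Finset.sum_congr rfl fun j _ => ?_
  ring

/-- The coordinates of a vector, extended by zero to a sequence. -/
def coord (y : Vec (p + 1)) (j : ℕ) : ℝ := if hj : j < p + 1 then y ⟨j, hj⟩ else 0

lemma coord_fin (y : Vec (p + 1)) (j : Fin (p + 1)) : coord y j = y j := by
  rw [coord, dif_pos j.isLt]

lemma coord_of_le (y : Vec (p + 1)) {j : ℕ} (hj : p < j) : coord y j = 0 := by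
  rw [coord, dif_neg (by omega)]

/-- The conservative part of the skew-symmetric field. -/
def skewDrift (k : ℕ → ℝ) (u : ℝ) (y : ℕ → ℝ) : ℕ → ℝ
  | 0 => u * y 1
  | m + 1 => -k (m + 2) * u * y m + u * y (m + 2)

lemma sum_ite_mul_coord (y : Vec (p + 1)) (m : ℕ) (c : ℝ) :
    ∑ j : Fin (p + 1), (if (j : ℕ) = m then c else 0) * y j = c * coord y m := by
  by_cases hm : m < p + 1
  · rw [Finset.sum_eq_single (⟨m, hm⟩ : Fin (p + 1))]
    · simp [coord, hm]
    · intro j _ hj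
      have : (j : ℕ) ≠ m := fun h => hj (Fin.ext h)
      simp [this]
    · simp
  · rw [coord, dif_neg hm, Finset.sum_eq_zero, mul_zero]
    intro j _
    have : (j : ℕ) ≠ m := by omega
    simp [this]

/-- Extending x̄ by zero lets all rows share one formula: in the last row the superdiagonal term
multiplies x̄_{n+1} = 0, and only the damping is exceptional. -/
lemma skewA_mulVec (k : ℕ → ℝ) (u : ℝ) (y : Vec (p + 1)) (i : Fin (p + 1)) :
    (skewA p k u).mulVec y.ofLp i =
      skewDrift k u (coord y) i - if (i : ℕ) = p then k (p + 2) * coord y p else 0 := by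
  have h1 : ∀ j : Fin (p + 1), skewA p k u i j * y j =
      (if (j : ℕ) = i + 1 then u else 0) * y j +
      (if (i : ℕ) = j + 1 then -k (j + 2) * u else 0) * y j +
      (if (j : ℕ) = p then (if (i : ℕ) = p then -k (p + 2) else 0) else 0) * y j := by
    intro j
    simp only [skewA, Matrix.of_apply]
    split_ifs <;> first | omega | ring
  have h2 : ∑ j : Fin (p + 1), (if (i : ℕ) = j + 1 then -k (j + 2) * u else 0) * y j =
      skewDrift k u (coord y) i - u * coord y (i + 1) := by
    rcases i with ⟨_ | m, hi⟩
    · simp [skewDrift]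
    · have : ∀ j : Fin (p + 1), (if m + 1 = (j : ℕ) + 1 then -k (j + 2) * u else 0) * y j =
          (if (j : ℕ) = m then -k (m + 2) * u else 0) * y j := by
        intro j
        by_cases hj : (j : ℕ) = m
        · simp [hj]
        · simp [hj, Ne.symm hj]
      simp only [this, sum_ite_mul_coord, skewDrift]
      ring
  change ∑ j, skewA p k u i j * y j = _
  simp only [h1, Finset.sum_add_distrib, h2, sum_ite_mul_coord]
  split_ifs <;> ring

/-- In the coordinates `(x_1, x̄)` the closed loop has the skew-symmetric form. -/
theorem skewCoord_chainedClosedLoop {k k' : ℕ → ℝ} (hkk' : GainsMatch p k' k)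
    (h : ℝ → Vec (p + 1) → ℝ) (t : ℝ) (x : Vec (p + 2)) :
    skewCoord k (chainedClosedLoop (k 1) k' h t x) = skewClosedLoop k h t (skewCoord k x) := by
  set u := controlU (k 1) h t x with hu
  set z := tail x with hz
  set w := tail (chainedClosedLoop (k 1) k' h t x) with hw
  have hw1 : ∀ j : Fin p, w j.castSucc = u * z j.succ := by
    intro j
    have h1 : (j : ℕ) + 1 + 1 < p + 2 := by omega
    simp only [hw, hz, tail_apply, chainedClosedLoop, chainedField, Fin.val_succ, Fin.val_castSucc,
      Nat.add_eq_zero_iff, one_ne_zero, and_false, if_false, h1, dif_pos, ← hu]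
    rfl
  have hw2 : w (Fin.last p) = recursiveFeedback k u z := by
    rw [← hkk' u z]
    simp [hw, tail_apply, chainedClosedLoop, chainedField, controlV, ← hu, ← hz]
  have hskew : toSkew k w = WithLp.toLp 2 ((skewA p k u).mulVec (toSkew k z).ofLp) := by
    ext i
    change toSkew k w i = (skewA p k u).mulVec (toSkew k z).ofLp i
    have hcoord : ∀ j ≤ p, coord (toSkew k z) j = evalForm (skewRec k j).1 z := fun j hj => by
      rw [coord, dif_pos (by omega), toSkew_apply]
    rw [skewA_mulVec, toSkew_apply]
    have hlow := fun m => (skewRec_low k m).1 1 (by norm_num)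
    have hlow' := fun m => (skewRec_low k m).2 1 (by norm_num)
    rcases i with ⟨_ | m, hi⟩
    -- When `p = 0` the first row is also the last, and its derivative is the feedback.
    · rcases Nat.eq_zero_or_pos p with hp | hp
      · subst hp
        have h2 : evalForm (skewRec k 0).1 w = w (Fin.last 0) := evalForm_single_last w
        rw [h2, hw2, recursiveFeedback, hcoord 0 le_rfl]
        simp [skewDrift, show (skewRec k 0).2 = 0 from rfl, evalForm_zero, coord_of_le]
      · rw [evalForm_of_shift ((skewRec_support k 0).1 _ (by omega)) (hlow 0) hw1]
        have h2 : shift (skewRec k 0).1 = (skewRec k 1).1 := by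
          ext j
          rcases j with _ | j
          · simp [shift, skewRec]
          · simp [shift, skewRec, Pi.single_apply]
        simp [skewDrift, hp.ne, h2, hcoord 1 hp]
    · have hrec : ∀ q, shift (skewRec k q).2 = (skewRec k (q + 1)).2 + k (q + 2) • (skewRec k q).1 :=
        fun q => by simp [skewRec]
      rcases Nat.lt_or_ge (m + 1) p with hm | hm
      · rw [evalForm_of_shift ((skewRec_support k (m + 1)).1 _ (by omega)) (hlow _) hw1]
        -- Interior row: the recursion for ∂v/∂u turns the shifted form into the next x̄ minus a
        -- gain times the previous x̄.
        have h2 : shift (skewRec k (m + 1)).1 =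
            (skewRec k (m + 2)).1 - k (m + 2) • (skewRec k m).1 := by
          have h3 : shift (skewRec k (m + 1)).1 =
              Pi.single (m + 4) 1 - shift (skewRec k m).2 := by
            ext j
            rcases j with _ | j
            · simp [shift]
            · simp [shift, skewRec, Pi.single_apply]
          rw [h3, hrec]
          simp only [skewRec]
          abel
        rw [h2, evalForm_sub, evalForm_smul]
        simp only [skewDrift, hm.ne, if_false, hcoord m (by omega), hcoord (m + 2) (by omega)]
        ring
      · obtain rfl : p = m + 1 := by omega
        -- Last row: x_n' = v_n brings u ∂v_n/∂u, which cancels against the derivative of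
        -- ∂v_{n-1}/∂u and leaves −k_{n-1} u x̄_{n-1} − k_n x̄_n.
        have h2 : evalForm (skewRec k (m + 1)).1 w =
            w (Fin.last _) - u * evalForm (shift (skewRec k m).2) z := by
          rw [← evalForm_of_shift ((skewRec_support k m).2 _ (by omega)) (hlow' m) hw1,
            ← evalForm_single_last, ← evalForm_sub]
          rfl
        rw [h2, hrec, hw2, recursiveFeedback, evalForm_add, evalForm_smul]
        simp only [skewDrift, if_true, hcoord m (by omega), hcoord (m + 1) le_rfl,
          coord_of_le _ (show m + 1 < m + 2 by omega)]
        ring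
  have h0 : (chainedClosedLoop (k 1) k' h t x) 0 = u := by
    simp [chainedClosedLoop, chainedField, ← hu]
  rw [skewCoord, skewClosedLoop, controlU_skewCoord, ← hw, hskew, h0]
  simp only [← hu, skewCoord, tail_pair, ← hz]

end Coordinates

/-! ### Uniform bounds on the input function -/

section Input

variable {d : ℕ}

/-- `H` is twice continuously differentiable and vanishes at the origin; its differential and the
differential of `∂H/∂t` are bounded at `(t,y)` by `N ‖y‖`. -/
structure TameInput (H : ℝ → Vec d → ℝ) (N : ℝ → ℝ) : Prop where
  contDiff : ContDiff ℝ 2 (Function.uncurry H)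
  zero : ∀ t, H t 0 = 0
  mono : Monotone N
  nonneg : ∀ r, 0 ≤ N r
  bound : ∀ t y, ‖fderiv ℝ (Function.uncurry H) (t, y)‖ ≤ N ‖y‖
  bound' : ∀ t y,
    ‖fderiv ℝ (fun q => fderiv ℝ (Function.uncurry H) q (1, 0)) (t, y)‖ ≤ N ‖y‖

/-- The partial derivative `∂H/∂t`. -/
def timeDeriv (H : ℝ → Vec d → ℝ) (q : ℝ × Vec d) : ℝ := fderiv ℝ (Function.uncurry H) q (1, 0)

lemma norm_le_of_coordDir_le (L : ℝ × Vec d →L[ℝ] ℝ) {r : ℝ} (hL : ∀ a, |L (coordDir a)| ≤ r) :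
    ‖L‖ ≤ (d + 1) * r := by
  have hr : 0 ≤ r := (abs_nonneg _).trans (hL none)
  refine L.opNorm_le_bound (by positivity) fun q => ?_
  have h1 : q = q.1 • coordDir none + ∑ i, q.2 i • coordDir (some i) := by
    refine Prod.ext ?_ ?_
    · simp [coordDir, Prod.fst_sum]
    · ext j
      simp [coordDir, Prod.snd_sum, WithLp.ofLp_sum, Finset.sum_apply, Pi.single_apply]
  have h2 : L q = q.1 * L (coordDir none) + ∑ i, q.2 i * L (coordDir (some i)) := by
    conv_lhs => rw [h1]
    simp only [map_add, map_sum, map_smul, smul_eq_mul]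
  have h3 : ∀ i, |q.2 i * L (coordDir (some i))| ≤ ‖q‖ * r := fun i => by
    rw [abs_mul]
    have : |q.2 i| ≤ ‖q‖ := (PiLp.norm_apply_le q.2 i).trans (norm_snd_le q)
    exact mul_le_mul this (hL _) (abs_nonneg _) (norm_nonneg _)
  have h4 : |q.1 * L (coordDir none)| ≤ ‖q‖ * r := by
    rw [abs_mul]
    exact mul_le_mul (norm_fst_le q) (hL _) (abs_nonneg _) (norm_nonneg _)
  rw [h2, Real.norm_eq_abs]
  calc _ ≤ |q.1 * L (coordDir none)| + |∑ i, q.2 i * L (coordDir (some i))| := abs_add_le _ _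
    _ ≤ ‖q‖ * r + ∑ i : Fin d, ‖q‖ * r :=
        add_le_add h4 ((Finset.abs_sum_le_sum_abs _ _).trans (Finset.sum_le_sum fun i _ => h3 i))
    _ = _ := by
      simp only [Finset.sum_const, Finset.card_univ, Fintype.card_fin, nsmul_eq_mul]
      ring

lemma TameInput.contDiff_timeDeriv {H : ℝ → Vec d → ℝ} {N : ℝ → ℝ} (hH : TameInput H N) :
    ContDiff ℝ 1 (timeDeriv H) :=
  (hH.contDiff.fderiv_right (m := 1) (by norm_num)).clm_apply contDiff_const

lemma exists_tameInput_of_partials {h : ℝ → Vec d → ℝ} (hz : ∀ t, h t 0 = 0)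
    (hb : HasBoundedPartials h) : ∃ N, TameInput h N := by
  obtain ⟨hc, ρ, hρ, hb⟩ := hb
  have hρ0 : ∀ r, 0 ≤ r → 0 ≤ ρ r := by
    intro r hr
    have h1 := (abs_nonneg _).trans ((hb 0 0).1 none)
    exact h1.trans (hρ (by simp) hr (by simpa using hr))
  have hpd : ∀ a q, partialDeriv a (Function.uncurry h) q =
      fderiv ℝ (Function.uncurry h) q (coordDir a) := fun a q =>
    ((hc.differentiable (by norm_num)) q).lineDeriv_eq_fderiv
  have hmax : ∀ y : Vec d, ρ ‖y‖ = ρ (max ‖y‖ 0) := fun y => by rw [max_eq_left (norm_nonneg y)]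
  -- `ρ` is monotone only on `[0, ∞)`; the `max` makes the bound monotone on ℝ. The factor `d + 1`
  -- counts the coordinates of (t, z).
  refine ⟨fun r => (d + 1) * ρ (max r 0), hc, hz, fun r s hrs => ?_, fun r => ?_, fun t y => ?_,
    fun t y => ?_⟩
  · exact mul_le_mul_of_nonneg_left (hρ (mem_Ici.2 (le_max_right _ _)) (mem_Ici.2 (le_max_right _ _))
      (max_le_max_right _ hrs)) (by positivity)
  · exact mul_nonneg (by positivity) (hρ0 _ (le_max_right _ _))
  · rw [← hmax]
    exact norm_le_of_coordDir_le _ fun a => by rw [← hpd]; exact (hb t y).1 a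
  · rw [← hmax]
    refine norm_le_of_coordDir_le _ fun a => ?_
    have h1 : (fun q => fderiv ℝ (Function.uncurry h) q (1, 0)) =
        partialDeriv none (Function.uncurry h) := funext fun q => (hpd none q).symm
    have h2 : ContDiff ℝ 1 (partialDeriv none (Function.uncurry h)) := by
      rw [← h1]
      exact (hc.fderiv_right (m := 1) (by norm_num)).clm_apply contDiff_const
    rw [h1, ← ((h2.differentiable (by norm_num)) (t, y)).lineDeriv_eq_fderiv]
    exact (hb t y).2 a none

/-- The bounds are assumed in z while the dynamics are studied in x̄; this transports them through
the inverse coordinate change. -/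
lemma TameInput.comp_linear {h : ℝ → Vec d → ℝ} {N : ℝ → ℝ} (hh : TameInput h N) {e : ℕ}
    (S : Vec e →L[ℝ] Vec d) : ∃ M, TameInput (fun t y => h t (S y)) M := by
  set J : ℝ × Vec e →L[ℝ] ℝ × Vec d := (ContinuousLinearMap.id ℝ ℝ).prodMap S with hJ
  have h0 : Function.uncurry (fun t y => h t (S y)) = Function.uncurry h ∘ J := rfl
  have h1 : ∀ q, fderiv ℝ (Function.uncurry h ∘ J) q = (fderiv ℝ (Function.uncurry h) (J q)).comp J :=
    fun q => by
      rw [fderiv_comp q ((hh.contDiff.differentiable (by norm_num)) _) J.differentiableAt, J.fderiv]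
  have h2 : (fun q => fderiv ℝ (Function.uncurry h ∘ J) q (1, 0)) = timeDeriv h ∘ J := by
    funext q
    rw [h1]
    simp [timeDeriv, hJ]
  have h3 : ∀ q, fderiv ℝ (timeDeriv h ∘ J) q = (fderiv ℝ (timeDeriv h) (J q)).comp J := fun q => by
    rw [fderiv_comp q ((hh.contDiff_timeDeriv.differentiable (by norm_num)) _) J.differentiableAt,
      J.fderiv]
  have h4 : ∀ (L : ℝ × Vec d →L[ℝ] ℝ) (y : Vec e), ‖L‖ ≤ N ‖S y‖ →
      ‖L.comp J‖ ≤ N (‖S‖ * ‖y‖) * ‖J‖ := fun L y hL =>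
    (L.opNorm_comp_le J).trans (mul_le_mul_of_nonneg_right
      (hL.trans (hh.mono (S.le_opNorm y))) (norm_nonneg _))
  refine ⟨fun r => N (‖S‖ * r) * ‖J‖, ?_, fun t => by simp [hh.zero], fun r s hrs => ?_, fun r => ?_,
    fun t y => ?_, fun t y => ?_⟩
  · rw [h0]
    exact hh.contDiff.comp J.contDiff
  · exact mul_le_mul_of_nonneg_right
      (hh.mono (mul_le_mul_of_nonneg_left hrs (norm_nonneg _))) (norm_nonneg _)
  · exact mul_nonneg (hh.nonneg _) (norm_nonneg _)
  · rw [h0, h1]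
    exact h4 _ y (hh.bound t (S y))
  · rw [h0, h2, h3]
    exact h4 _ y (hh.bound' t (S y))

/-- `ofSkew` as a continuous linear map. -/
def ofSkewCLM (p : ℕ) (k : ℕ → ℝ) : Vec (p + 1) →L[ℝ] Vec (p + 1) :=
  LinearMap.toContinuousLinearMap
    ({ toFun := ofSkew k
       map_add' := fun x y => by ext i; simp [ofSkew, Matrix.mulVec_add]
       map_smul' := fun c x => by ext i; simp [ofSkew, Matrix.mulVec_smul] } :
      Vec (p + 1) →ₗ[ℝ] Vec (p + 1))

lemma exists_tameInput_skewH {p : ℕ} (k : ℕ → ℝ) {h : ℝ → Vec (p + 1) → ℝ}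
    (hz : ∀ t, h t 0 = 0) (hb : HasBoundedPartials h) : ∃ N, TameInput (skewH k h) N := by
  obtain ⟨M, hM⟩ := exists_tameInput_of_partials hz hb
  exact hM.comp_linear (ofSkewCLM p k)

variable {H : ℝ → Vec d → ℝ} {N : ℝ → ℝ}

/-- Mean value inequality on the ball of radius `r`, starting from the origin, where `H t` vanishes.
-/
lemma TameInput.abs_le (hH : TameInput H N) (t : ℝ) {y : Vec d} {r : ℝ} (hy : ‖y‖ ≤ r) :
    |H t y| ≤ N r * r := by
  have h1 : ∀ w ∈ Metric.closedBall (0 : Vec d) r, HasFDerivWithinAt (H t)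
      ((fderiv ℝ (Function.uncurry H) (t, w)).comp (ContinuousLinearMap.inr ℝ ℝ (Vec d)))
      (Metric.closedBall 0 r) w := fun w _ =>
    (((hH.contDiff.differentiable (by norm_num)) (t, w)).hasFDerivAt.comp w
      (hasFDerivAt_prodMk_right t w)).hasFDerivWithinAt
  have h2 := (convex_closedBall (0 : Vec d) r).norm_image_sub_le_of_norm_hasFDerivWithin_le
    (C := N r) h1 (fun w hw => ?_) (Metric.mem_closedBall_self ((norm_nonneg y).trans hy))
    (y := y) (by simpa using hy)
  · rw [hH.zero, sub_zero, sub_zero] at h2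
    exact h2.trans (mul_le_mul_of_nonneg_left hy (hH.nonneg _))
  · calc _ ≤ ‖fderiv ℝ (Function.uncurry H) (t, w)‖ * ‖ContinuousLinearMap.inr ℝ ℝ (Vec d)‖ :=
          ContinuousLinearMap.opNorm_comp_le _ _
      _ ≤ N ‖w‖ * 1 := mul_le_mul (hH.bound t w) (ContinuousLinearMap.norm_inr_le_one ℝ ℝ _)
          (norm_nonneg _) (hH.nonneg _)
      _ ≤ N r := by rw [mul_one]; exact hH.mono (by simpa using hw)

/-- Mean value inequality for ∂H/∂t. It allows the moving point x̄(t) to be replaced by a frozen one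
in the excitation integral. -/
lemma TameInput.abs_timeDeriv_sub_le (hH : TameInput H N) (t : ℝ) {y w : Vec d} {r : ℝ}
    (hy : ‖y‖ ≤ r) (hw : ‖w‖ ≤ r) :
    |timeDeriv H (t, y) - timeDeriv H (t, w)| ≤ N r * ‖y - w‖ := by
  have h1 : ∀ w ∈ Metric.closedBall (0 : Vec d) r, HasFDerivWithinAt (fun w => timeDeriv H (t, w))
      ((fderiv ℝ (timeDeriv H) (t, w)).comp (ContinuousLinearMap.inr ℝ ℝ (Vec d)))
      (Metric.closedBall 0 r) w := fun w _ =>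
    (((hH.contDiff_timeDeriv.differentiable (by norm_num)) (t, w)).hasFDerivAt.comp w
      (hasFDerivAt_prodMk_right t w)).hasFDerivWithinAt
  refine (convex_closedBall (0 : Vec d) r).norm_image_sub_le_of_norm_hasFDerivWithin_le
    (C := N r) h1 (fun w hw => ?_) (by simpa using hw) (by simpa using hy)
  calc _ ≤ ‖fderiv ℝ (timeDeriv H) (t, w)‖ * ‖ContinuousLinearMap.inr ℝ ℝ (Vec d)‖ :=
        ContinuousLinearMap.opNorm_comp_le _ _
    _ ≤ N ‖w‖ * 1 := mul_le_mul (hH.bound' t w) (ContinuousLinearMap.norm_inr_le_one ℝ ℝ _)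
        (norm_nonneg _) (hH.nonneg _)
    _ ≤ N r := by rw [mul_one]; exact hH.mono (by simpa using hw)

lemma deriv_eq_timeDeriv (hH : TameInput H N) (t : ℝ) (y : Vec d) :
    deriv (fun s => H s y) t = timeDeriv H (t, y) := by
  have h1 := ((hH.contDiff.differentiable (by norm_num)) (t, y)).hasFDerivAt.comp_hasDerivAt t
    ((hasDerivAt_id t).prodMk (hasDerivAt_const t y))
  exact h1.deriv

end Input

/-! ### A scalar comparison estimate -/

section ScalarComparison

/-- With integrating factor exp(cΘ), the quantity exp(cΘ)(a − β/c) is nonincreasing. The speed θ ≥ 0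
allows for cutoff fields, and Θ is the rescaled time. -/
lemma le_of_stable_scalar {c β t₀ t₁ : ℝ} (hc : 0 < c) (ht : t₀ ≤ t₁) {a b θ Θ : ℝ → ℝ}
    (ha : ∀ t ∈ Icc t₀ t₁, HasDerivWithinAt a (θ t * (-c * a t + b t)) (Icc t₀ t₁) t)
    (hΘ : ∀ t ∈ Icc t₀ t₁, HasDerivWithinAt Θ (θ t) (Icc t₀ t₁) t)
    (hθ : ∀ t, 0 ≤ θ t) (hb : ∀ t ∈ Icc t₀ t₁, |b t| ≤ β) :
    a t₁ ≤ Real.exp (-c * (Θ t₁ - Θ t₀)) * |a t₀| + β / c := by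
  have hβ : 0 ≤ β := (abs_nonneg _).trans (hb t₀ ⟨le_rfl, ht⟩)
  have hd : ∀ t ∈ Icc t₀ t₁, HasDerivWithinAt (fun t => Real.exp (c * Θ t) * (a t - β / c))
      (Real.exp (c * Θ t) * (θ t * (b t - β))) (Icc t₀ t₁) t := by
    intro t h
    refine (((hΘ t h).const_mul c).exp.mul ((ha t h).sub_const (β / c))).congr_deriv ?_
    field_simp
    ring
  have hanti : AntitoneOn (fun t => Real.exp (c * Θ t) * (a t - β / c)) (Icc t₀ t₁) :=
    antitoneOn_of_hasDerivWithinAt_nonpos (convex_Icc _ _) (fun t h => (hd t h).continuousWithinAt)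
      (fun t h => (hd t (interior_subset h)).mono interior_subset) fun t h =>
        mul_nonpos_of_nonneg_of_nonpos (Real.exp_pos _).le
          (mul_nonpos_of_nonneg_of_nonpos (hθ t)
            (by linarith [le_abs_self (b t), hb t (interior_subset h)]))
  have h1 := hanti ⟨le_rfl, ht⟩ ⟨ht, le_rfl⟩ ht
  simp only at h1
  have h2 : Real.exp (-c * (Θ t₁ - Θ t₀)) = Real.exp (c * Θ t₀) / Real.exp (c * Θ t₁) := by
    rw [← Real.exp_sub]
    ring_nf
  have h3 : a t₁ - β / c ≤ Real.exp (-c * (Θ t₁ - Θ t₀)) * (a t₀ - β / c) := by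
    rw [h2, div_mul_eq_mul_div, le_div_iff₀ (Real.exp_pos _), mul_comm]
    exact h1
  have h4 : a t₀ - β / c ≤ |a t₀| := by
    have : 0 ≤ β / c := by positivity
    linarith [le_abs_self (a t₀)]
  have h5 := mul_le_mul_of_nonneg_left h4 (Real.exp_pos (-c * (Θ t₁ - Θ t₀))).le
  linarith

lemma abs_le_of_stable_scalar {c β t₀ t₁ : ℝ} (hc : 0 < c) (ht : t₀ ≤ t₁) {a b θ Θ : ℝ → ℝ}
    (ha : ∀ t ∈ Icc t₀ t₁, HasDerivWithinAt a (θ t * (-c * a t + b t)) (Icc t₀ t₁) t)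
    (hΘ : ∀ t ∈ Icc t₀ t₁, HasDerivWithinAt Θ (θ t) (Icc t₀ t₁) t)
    (hθ : ∀ t, 0 ≤ θ t) (hb : ∀ t ∈ Icc t₀ t₁, |b t| ≤ β) :
    |a t₁| ≤ Real.exp (-c * (Θ t₁ - Θ t₀)) * |a t₀| + β / c := by
  refine abs_le'.2 ⟨le_of_stable_scalar hc ht ha hΘ hθ hb, ?_⟩
  have h1 := le_of_stable_scalar hc ht (a := fun t => -a t) (b := fun t => -b t) (β := β)
    (fun t h => (ha t h).neg.congr_deriv (by ring)) hΘ hθ (fun t h => by simpa using hb t h)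
  simpa using h1

end ScalarComparison

/-! ### The Lyapunov function and its derivative -/

section Lyapunov

variable {p : ℕ} {k : ℕ → ℝ}

/-- The product `k_2 ⋯ k_{j+1}`, the inverse of a weight of the Lyapunov function. -/
def lyapWeight (k : ℕ → ℝ) (j : ℕ) : ℝ := ∏ i ∈ Finset.range j, k (i + 2)

lemma lyapWeight_pos (hk : ∀ i, 1 ≤ i → i ≤ p + 2 → 0 < k i) {j : ℕ} (hj : j ≤ p) :
    0 < lyapWeight k j :=
  Finset.prod_pos fun i hi => hk _ (by omega) (by have := Finset.mem_range.1 hi; omega)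

/-- The Lyapunov function `∑_{i=2}^n x̄_i² / (k_2 ⋯ k_{i-1})`. -/
def lyap (p : ℕ) (k : ℕ → ℝ) (y : Vec (p + 1)) : ℝ :=
  ∑ j ∈ Finset.range (p + 1), coord y j ^ 2 / lyapWeight k j

lemma norm_sq_eq_sum_coord (y : Vec (p + 1)) :
    ‖y‖ ^ 2 = ∑ j ∈ Finset.range (p + 1), coord y j ^ 2 := by
  rw [EuclideanSpace.norm_sq_eq, Finset.sum_range]
  simp [coord_fin]

lemma abs_coord_le (y : Vec (p + 1)) (j : ℕ) : |coord y j| ≤ ‖y‖ := by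
  by_cases hj : j < p + 1
  · rw [coord, dif_pos hj]
    exact PiLp.norm_apply_le y _
  · simp [coord, hj]

lemma norm_le_sum_abs_coord (y : Vec (p + 1)) :
    ‖y‖ ≤ ∑ j ∈ Finset.range (p + 1), |coord y j| := by
  refine le_of_sq_le_sq ?_ (Finset.sum_nonneg fun _ _ => abs_nonneg _)
  rw [norm_sq_eq_sum_coord]
  simp only [← sq_abs (coord y _)]
  exact Finset.sum_sq_le_sq_sum_of_nonneg fun _ _ => abs_nonneg _

lemma exists_lyap_bounds (hk : ∀ i, 1 ≤ i → i ≤ p + 2 → 0 < k i) :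
    ∃ c : ℝ, 0 < c ∧ (∀ y : Vec (p + 1), lyap p k y ≤ c * ‖y‖ ^ 2) ∧
      ∀ y : Vec (p + 1), ‖y‖ ^ 2 ≤ c * lyap p k y := by
  have hpos : ∀ j ∈ Finset.range (p + 1), 0 < lyapWeight k j := fun j hj =>
    lyapWeight_pos hk (Nat.lt_succ_iff.1 (Finset.mem_range.1 hj))
  -- Summing all weights and their inverses gives one constant for both inequalities.
  set c := ∑ j ∈ Finset.range (p + 1), (lyapWeight k j + (lyapWeight k j)⁻¹) with hc
  have hle : ∀ j ∈ Finset.range (p + 1), lyapWeight k j + (lyapWeight k j)⁻¹ ≤ c := fun j hj =>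
    Finset.single_le_sum (f := fun j => lyapWeight k j + (lyapWeight k j)⁻¹)
      (fun i hi => (add_pos (hpos i hi) (inv_pos.2 (hpos i hi))).le) hj
  have hc0 : 0 < c := by
    refine Finset.sum_pos (fun i hi => add_pos (hpos i hi) (inv_pos.2 (hpos i hi))) ⟨0, by simp⟩
  refine ⟨c, hc0, fun y => ?_, fun y => ?_⟩
  · rw [norm_sq_eq_sum_coord, lyap, Finset.mul_sum]
    refine Finset.sum_le_sum fun j hj => ?_
    rw [div_eq_mul_inv, mul_comm]
    exact mul_le_mul_of_nonneg_right (by linarith [hle j hj, hpos j hj]) (sq_nonneg _)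
  · rw [norm_sq_eq_sum_coord, lyap, Finset.mul_sum]
    refine Finset.sum_le_sum fun j hj => ?_
    have h1 : lyapWeight k j ≤ c := by linarith [hle j hj, inv_pos.2 (hpos j hj)]
    rw [mul_div_assoc', le_div_iff₀ (hpos j hj), mul_comm]
    exact mul_le_mul_of_nonneg_right h1 (sq_nonneg _)

lemma lyap_nonneg (hk : ∀ i, 1 ≤ i → i ≤ p + 2 → 0 < k i) (y : Vec (p + 1)) : 0 ≤ lyap p k y := by
  refine Finset.sum_nonneg fun j hj => div_nonneg (sq_nonneg _) (lyapWeight_pos hk ?_).le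
  exact Nat.lt_succ_iff.1 (Finset.mem_range.1 hj)

/-- The components of the field `A(u) x̄`. -/
def skewRate (p : ℕ) (k : ℕ → ℝ) (u : ℝ) (y : ℕ → ℝ) (j : ℕ) : ℝ :=
  skewDrift k u y j - if j = p then k (p + 2) * y p else 0

/-- The sum telescopes: consecutive weights differ by the factor k_{j+2}, so each subdiagonal cross
term cancels the preceding superdiagonal one and only a boundary term remains. -/
lemma sum_skewDrift (hk : ∀ i, 1 ≤ i → i ≤ p + 2 → 0 < k i) (u : ℝ) (y : ℕ → ℝ) {n : ℕ}
    (hn : n ≤ p) :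
    ∑ j ∈ Finset.range (n + 1), 2 * y j * skewDrift k u y j / lyapWeight k j =
      2 * u * y n * y (n + 1) / lyapWeight k n := by
  induction n with
  | zero => simp [skewDrift, lyapWeight]; ring
  | succ n ih =>
    have h1 : lyapWeight k (n + 1) = lyapWeight k n * k (n + 2) := Finset.prod_range_succ _ _
    have h2 := (lyapWeight_pos hk (show n ≤ p by omega)).ne'
    have h3 := (hk (n + 2) (by omega) (by omega)).ne'
    rw [Finset.sum_range_succ, ih (by omega), h1, skewDrift]
    field_simp
    ring

/-- The boundary term contains x̄_{n+1} = 0, so V decreases only through the damping, independently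
of u. -/
lemma sum_skewRate (hk : ∀ i, 1 ≤ i → i ≤ p + 2 → 0 < k i) (u : ℝ) (y : Vec (p + 1)) :
    ∑ j ∈ Finset.range (p + 1), 2 * coord y j * skewRate p k u (coord y) j / lyapWeight k j =
      -(2 * k (p + 2) / lyapWeight k p) * coord y p ^ 2 := by
  have h1 := sum_skewDrift hk u (coord y) le_rfl
  rw [coord_of_le y (Nat.lt_succ_self p), mul_zero, zero_div] at h1
  have h2 : ∀ j ∈ Finset.range (p + 1),
      2 * coord y j * skewRate p k u (coord y) j / lyapWeight k j =
      2 * coord y j * skewDrift k u (coord y) j / lyapWeight k j +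
      if j = p then -(2 * k (p + 2) / lyapWeight k p) * coord y p ^ 2 else 0 := fun j _ => by
    rw [skewRate]
    split_ifs with h
    · subst h; ring
    · ring
  rw [Finset.sum_congr rfl h2, Finset.sum_add_distrib, h1, zero_add]
  simp

end Lyapunov

/-! ### A priori bounds, completeness and uniform stability -/

section Trajectories

variable {p : ℕ} {k : ℕ → ℝ} {H : ℝ → Vec (p + 1) → ℝ} {N : ℝ → ℝ}

/-- The skew-symmetric closed loop with a general input function of `(t, x̄)`. -/
def skewField (k : ℕ → ℝ) (H : ℝ → Vec (p + 1) → ℝ) (t : ℝ) (X : Vec (p + 2)) : Vec (p + 2) :=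
  pair (controlU (k 1) H t X)
    (WithLp.toLp 2 ((skewA p k (controlU (k 1) H t X)).mulVec (tail X).ofLp))

lemma hasDerivWithinAt_apply {d : ℕ} {X : ℝ → Vec d} {X' : Vec d} {S : Set ℝ} {t : ℝ}
    (hX : HasDerivWithinAt X X' S t) (i : Fin d) : HasDerivWithinAt (fun t => X t i) (X' i) S t :=
  (EuclideanSpace.proj i : Vec d →L[ℝ] ℝ).hasFDerivAt.comp_hasDerivWithinAt t hX

/-- Here θ is the value of a cutoff along the curve; θ = 1 for genuine solutions. -/
lemma hasDerivWithinAt_zero_component {X : ℝ → Vec (p + 2)} {S : Set ℝ} {t θ : ℝ}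
    (hX : HasDerivWithinAt X (θ • skewField k H t (X t)) S t) :
    HasDerivWithinAt (fun t => X t 0) (θ * (-k 1 * X t 0 + H t (tail (X t)))) S t :=
  hasDerivWithinAt_apply hX 0

lemma hasDerivWithinAt_coord_tail {X : ℝ → Vec (p + 2)} {S : Set ℝ} {t θ : ℝ}
    (hX : HasDerivWithinAt X (θ • skewField k H t (X t)) S t) {j : ℕ} (hj : j ≤ p) :
    HasDerivWithinAt (fun t => coord (tail (X t)) j)
      (θ * skewRate p k (controlU (k 1) H t (X t)) (coord (tail (X t))) j) S t := by
  have hj' : j < p + 1 := Nat.lt_succ_iff.2 hj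
  have h1 := hasDerivWithinAt_apply hX (⟨j, hj'⟩ : Fin (p + 1)).succ
  have h2 : (fun t => coord (tail (X t)) j) = fun t => X t (⟨j, hj'⟩ : Fin (p + 1)).succ := by
    funext t
    rw [coord, dif_pos hj']
    rfl
  rw [h2]
  refine h1.congr_deriv ?_
  change θ * ((skewA p k (controlU (k 1) H t (X t))).mulVec (tail (X t)).ofLp ⟨j, hj'⟩) = _
  rw [skewA_mulVec]
  rfl

lemma hasDerivWithinAt_lyap (hk : ∀ i, 1 ≤ i → i ≤ p + 2 → 0 < k i) {X : ℝ → Vec (p + 2)}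
    {S : Set ℝ} {t θ : ℝ} (hX : HasDerivWithinAt X (θ • skewField k H t (X t)) S t) :
    HasDerivWithinAt (fun t => lyap p k (tail (X t)))
      (θ * (-(2 * k (p + 2) / lyapWeight k p) * coord (tail (X t)) p ^ 2)) S t := by
  rw [← sum_skewRate hk (controlU (k 1) H t (X t)), Finset.mul_sum]
  refine HasDerivWithinAt.fun_sum fun j hj => ?_
  have h1 := hasDerivWithinAt_coord_tail hX (Nat.lt_succ_iff.1 (Finset.mem_range.1 hj))
  exact ((h1.pow 2).div_const _).congr_deriv (by ring)

lemma antitoneOn_lyap (hk : ∀ i, 1 ≤ i → i ≤ p + 2 → 0 < k i) {X : ℝ → Vec (p + 2)}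
    {S : Set ℝ} (hS : Convex ℝ S) {θ : ℝ → ℝ} (hθ : ∀ t, 0 ≤ θ t)
    (hX : ∀ t ∈ S, HasDerivWithinAt X (θ t • skewField k H t (X t)) S t) :
    AntitoneOn (fun t => lyap p k (tail (X t))) S :=
  antitoneOn_of_hasDerivWithinAt_nonpos hS
    (fun t h => (hasDerivWithinAt_lyap hk (hX t h)).continuousWithinAt)
    (fun t h => (hasDerivWithinAt_lyap hk (hX t (interior_subset h))).mono interior_subset)
    fun t _ => by
      have h1 := hk (p + 2) (by omega) le_rfl
      have h2 := lyapWeight_pos hk (le_refl p)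
      refine mul_nonpos_of_nonneg_of_nonpos (hθ t) ?_
      rw [neg_mul]
      have : 0 ≤ 2 * k (p + 2) / lyapWeight k p * coord (tail (X t)) p ^ 2 := by positivity
      linarith

lemma norm_sq_eq_add_norm_tail_sq (x : Vec (p + 2)) : ‖x‖ ^ 2 = |x 0| ^ 2 + ‖tail x‖ ^ 2 := by
  rw [EuclideanSpace.norm_sq_eq, EuclideanSpace.norm_sq_eq (tail x), Fin.sum_univ_succ]
  rfl

lemma norm_tail_le (x : Vec (p + 2)) : ‖tail x‖ ≤ ‖x‖ := by
  refine le_of_sq_le_sq ?_ (norm_nonneg _)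
  rw [norm_sq_eq_add_norm_tail_sq x]
  exact le_add_of_nonneg_left (sq_nonneg _)

lemma norm_le_abs_add_norm_tail (x : Vec (p + 2)) : ‖x‖ ≤ |x 0| + ‖tail x‖ := by
  refine le_of_sq_le_sq ?_ (by positivity)
  rw [norm_sq_eq_add_norm_tail_sq]
  nlinarith [mul_nonneg (abs_nonneg (x 0)) (norm_nonneg (tail x))]

/-- The Lyapunov function bounds `x̄` by its value at any earlier time. -/
lemma exists_norm_tail_le (p : ℕ) {k : ℕ → ℝ} (hk : ∀ i, 1 ≤ i → i ≤ p + 2 → 0 < k i) :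
    ∃ c : ℝ, 0 < c ∧ ∀ (H : ℝ → Vec (p + 1) → ℝ) (X : ℝ → Vec (p + 2)) (S : Set ℝ),
      Convex ℝ S → ∀ θ : ℝ → ℝ, (∀ t, 0 ≤ θ t) →
      (∀ t ∈ S, HasDerivWithinAt X (θ t • skewField k H t (X t)) S t) →
      ∀ s ∈ S, ∀ t ∈ S, s ≤ t → ‖tail (X t)‖ ≤ c * ‖tail (X s)‖ := by
  obtain ⟨c, hc, h1, h2⟩ := exists_lyap_bounds hk
  refine ⟨c, hc, fun H X S hS θ hθ hX s hs t ht hst => ?_⟩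
  refine le_of_sq_le_sq ?_ (by positivity)
  have h3 := antitoneOn_lyap hk hS hθ hX hs ht hst
  calc _ ≤ c * lyap p k (tail (X t)) := h2 _
    _ ≤ c * lyap p k (tail (X s)) := mul_le_mul_of_nonneg_left h3 hc.le
    _ ≤ c * (c * ‖tail (X s)‖ ^ 2) := mul_le_mul_of_nonneg_left (h1 _) hc.le
    _ = _ := by ring

/-- An a priori bound, valid along all solutions of the field multiplied by a function with values
in `[0,1]`. -/
lemma exists_norm_le (hk : ∀ i, 1 ≤ i → i ≤ p + 2 → 0 < k i) (hH : TameInput H N) :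
    ∃ c : ℝ, 0 < c ∧ ∀ (X : ℝ → Vec (p + 2)) (t₀ t₁ : ℝ), t₀ ≤ t₁ → ∀ θ : ℝ → ℝ, (∀ t, 0 ≤ θ t) →
      ContinuousOn θ (Icc t₀ t₁) →
      (∀ t ∈ Icc t₀ t₁, HasDerivWithinAt X (θ t • skewField k H t (X t)) (Icc t₀ t₁) t) →
      ‖X t₁‖ ≤ (1 + c + N (c * ‖X t₀‖) * c / k 1) * ‖X t₀‖ := by
  obtain ⟨c, hc, hc'⟩ := exists_norm_tail_le p hk
  have hk1 := hk 1 le_rfl (by omega)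
  refine ⟨c, hc, fun X t₀ t₁ ht θ hθ hθc hX => ?_⟩
  have hy : ∀ t ∈ Icc t₀ t₁, ‖tail (X t)‖ ≤ c * ‖X t₀‖ := fun t h =>
    (hc' H X _ (convex_Icc t₀ t₁) θ hθ hX t₀ ⟨le_rfl, ht⟩ t h h.1).trans
      (mul_le_mul_of_nonneg_left (norm_tail_le _) hc.le)
  -- `θ` is continuous only on the interval; extending it by its end values gives a primitive
  -- differentiable everywhere.
  set ϑ : ℝ → ℝ := IccExtend ht ((Icc t₀ t₁).domRestrict θ) with hϑ
  have hϑc : Continuous ϑ := (continuousOn_iff_continuous_domRestrict.1 hθc).Icc_extend'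
  have hϑe : ∀ t ∈ Icc t₀ t₁, ϑ t = θ t := fun t h => by
    rw [hϑ, IccExtend_of_mem ht _ h]
    rfl
  have hϑ0 : ∀ t, 0 ≤ ϑ t := fun t => hθ _
  set Θ : ℝ → ℝ := fun t => ∫ s in t₀..t, ϑ s with hΘ
  have hΘd : ∀ t, HasDerivAt Θ (ϑ t) t := fun t =>
    intervalIntegral.integral_hasDerivAt_right (hϑc.intervalIntegrable _ _)
      (hϑc.stronglyMeasurableAtFilter _ _) hϑc.continuousAt
  have h1 := abs_le_of_stable_scalar (a := fun t => X t 0) (b := fun t => H t (tail (X t)))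
    (θ := ϑ) (Θ := Θ) (β := N (c * ‖X t₀‖) * (c * ‖X t₀‖)) hk1 ht
    (fun t h => by rw [hϑe t h]; exact hasDerivWithinAt_zero_component (hX t h))
    (fun t h => (hΘd t).hasDerivWithinAt) hϑ0 (fun t h => hH.abs_le t (hy t h))
  -- The cutoff may vanish, so no decay is available here; only exp ≤ 1 is used.
  have h2 : Real.exp (-k 1 * (Θ t₁ - Θ t₀)) ≤ 1 := by
    rw [Real.exp_le_one_iff]
    have h3 : Θ t₀ ≤ Θ t₁ :=
      monotone_of_deriv_nonneg (fun t => (hΘd t).differentiableAt)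
        (fun t => by rw [(hΘd t).deriv]; exact hϑ0 t) ht
    nlinarith
  have h4 : |X t₀ 0| ≤ ‖X t₀‖ := PiLp.norm_apply_le (X t₀) 0
  have h5 : Real.exp (-k 1 * (Θ t₁ - Θ t₀)) * |X t₀ 0| ≤ ‖X t₀‖ :=
    (mul_le_of_le_one_left (abs_nonneg _) h2).trans h4
  calc _ ≤ |X t₁ 0| + ‖tail (X t₁)‖ := norm_le_abs_add_norm_tail _
    _ ≤ (‖X t₀‖ + N (c * ‖X t₀‖) * (c * ‖X t₀‖) / k 1) + c * ‖X t₀‖ :=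
        add_le_add (h1.trans (by linarith)) (hy t₁ ⟨ht, le_rfl⟩)
    _ = _ := by ring

lemma contDiff_skewField (hH : TameInput H N) :
    ContDiff ℝ 1 (Function.uncurry (skewField k H)) := by
  have hx : ∀ i : Fin (p + 2), ContDiff ℝ 1 (fun q : ℝ × Vec (p + 2) => q.2 i) := fun i =>
    (contDiff_piLp 2).1 contDiff_snd i
  have htail : ContDiff ℝ 1 (fun q : ℝ × Vec (p + 2) => tail q.2) :=
    (contDiff_piLp 2).2 fun i => hx i.succ
  have hu : ContDiff ℝ 1 (fun q : ℝ × Vec (p + 2) => controlU (k 1) H q.1 q.2) :=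
    (contDiff_const.mul (hx 0)).add
      ((hH.contDiff.of_le (by norm_num)).comp (contDiff_fst.prodMk htail))
  have hA : ∀ i j : Fin (p + 1), ContDiff ℝ 1 (fun q : ℝ × Vec (p + 2) =>
      skewA p k (controlU (k 1) H q.1 q.2) i j) := fun i j => by
    simp only [skewA, Matrix.of_apply]
    split_ifs
    · exact hu
    · exact contDiff_const.mul hu
    · exact contDiff_const
    · exact contDiff_const
  refine (contDiff_piLp 2).2 fun i => ?_
  refine Fin.cases ?_ (fun j => ?_) i
  · exact hu
  · exact ContDiff.sum (s := Finset.univ) (f := fun l (q : ℝ × Vec (p + 2)) =>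
      skewA p k (controlU (k 1) H q.1 q.2) j l * q.2 l.succ) fun l _ => (hA j l).mul (hx l.succ)

/-- The bound of `exists_norm_le` depends only on the initial state, neither on the cutoff nor on
the length of the interval. -/
theorem isForwardComplete_skewField (hk : ∀ i, 1 ≤ i → i ≤ p + 2 → 0 < k i)
    (hH : TameInput H N) : IsForwardComplete (skewField k H) := by
  obtain ⟨c, hc, h1⟩ := exists_norm_le hk hH
  refine isForwardComplete_of_bound (contDiff_skewField hH)
    (fun x => (1 + c + N (c * ‖x‖) * c / k 1) * ‖x‖) fun χ hχ hχ' t₀ t₁ ht X hX => ?_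
  exact h1 X t₀ t₁ ht (fun t => χ (X t)) (fun t => (hχ' _).1) (hχ.comp_continuousOn hX.continuousOn)
    hX

/-- Every function `s ↦ (1 + M s) s` with `M` nonnegative and nondecreasing is bounded by a function
of class `K_∞`. -/
lemma exists_isClassKInfty_ge {M : ℝ → ℝ} (hM : Monotone M) (hM0 : ∀ s, 0 ≤ M s) :
    ∃ γ, IsClassKInfty γ ∧ ∀ s, 0 ≤ s → (1 + M s) * s ≤ γ s := by
  have hint : ∀ a b, IntervalIntegrable M volume a b := fun a b => hM.intervalIntegrable
  -- Averaging `M` over `[s, s + 1]` gives a continuous nondecreasing majorant of a possibly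
  -- discontinuous `M`.
  set J : ℝ → ℝ := fun s => ∫ r in (0 : ℝ)..1, M (r + s) with hJ
  have hint' : ∀ s, IntervalIntegrable (fun r => M (r + s)) volume 0 1 := fun s =>
    Monotone.intervalIntegrable fun a b hab => hM (by linarith)
  have hJmono : Monotone J := fun a b hab =>
    intervalIntegral.integral_mono_on zero_le_one (hint' a) (hint' b)
      fun r _ => hM (by linarith)
  have hJge : ∀ s, M s ≤ J s := fun s => by
    have h1 : ∫ r in (0 : ℝ)..1, M s ≤ J s :=
      intervalIntegral.integral_mono_on zero_le_one (by simp) (hint' s)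
        fun r hr => hM (by linarith [hr.1])
    simpa using h1
  have hJ0 : ∀ s, 0 ≤ J s := fun s => (hM0 s).trans (hJge s)
  have hJc : Continuous J := by
    have h1 : J = fun s => (∫ r in (0 : ℝ)..(1 + s), M r) - ∫ r in (0 : ℝ)..s, M r := by
      funext s
      rw [intervalIntegral.integral_interval_sub_left (hint _ _) (hint _ _), hJ]
      simp only [intervalIntegral.integral_comp_add_right, zero_add]
    rw [h1]
    have h2 := intervalIntegral.continuous_primitive hint 0
    exact (h2.comp (continuous_const.add continuous_id)).sub h2
  refine ⟨fun s => (1 + J s) * s, ⟨?_, ?_, by simp, ?_⟩, fun s hs => ?_⟩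
  · exact ((continuous_const.add hJc).mul continuous_id).continuousOn
  · intro a ha b hb hab
    have ha' : 0 ≤ a := ha
    have h1 : (1 + J a) * a ≤ (1 + J b) * a :=
      mul_le_mul_of_nonneg_right (by linarith [hJmono hab.le]) ha'
    have h2 : (1 + J b) * a < (1 + J b) * b :=
      mul_lt_mul_of_pos_left hab (by linarith [hJ0 b])
    exact h1.trans_lt h2
  · refine tendsto_atTop_mono' _ ?_ tendsto_id
    filter_upwards [eventually_ge_atTop 0] with s hs
    have := mul_nonneg (hJ0 s) hs
    simp only [id]
    linarith
  · exact mul_le_mul_of_nonneg_right (by linarith [hJge s]) hs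

theorem isUGS_skewField (hk : ∀ i, 1 ≤ i → i ≤ p + 2 → 0 < k i) (hH : TameInput H N) :
    IsUGS (skewField k H) := by
  obtain ⟨c, hc, h1⟩ := exists_norm_le hk hH
  have hk1 := hk 1 le_rfl (by omega)
  obtain ⟨γ, hγ, hγ'⟩ := exists_isClassKInfty_ge (M := fun s => c + N (c * s) * c / k 1)
    (fun a b hab => by
      have := hH.mono (mul_le_mul_of_nonneg_left hab hc.le)
      simp only
      gcongr)
    (fun s => by have := hH.nonneg (c * s); positivity)
  refine ⟨γ, hγ, fun t₀ X hX t ht => ?_⟩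
  have h2 := h1 X t₀ t ht (fun _ => 1) (fun _ => zero_le_one) continuousOn_const
    fun s hs => by simpa using (hX.mono Icc_subset_Ici_self) s hs
  refine (h2.trans (le_of_eq ?_)).trans (hγ' _ (norm_nonneg _))
  ring

end Trajectories

/-! ### Uniform smallness on moving windows and a Barbalat lemma -/

section Windows

variable {s : ℕ → ℝ} {L : ℝ} {F G : ℕ → ℝ → ℝ}

/-- The functions `F m` converge to zero uniformly on the windows `[s m, s m + L]`. -/
def Vanishes (s : ℕ → ℝ) (L : ℝ) (F : ℕ → ℝ → ℝ) : Prop :=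
  ∀ ε > 0, ∀ᶠ m in atTop, ∀ t ∈ Icc (s m) (s m + L), |F m t| ≤ ε

/-- The functions `F m` are uniformly bounded on the windows `[s m, s m + L]`. -/
def WindowBdd (s : ℕ → ℝ) (L : ℝ) (F : ℕ → ℝ → ℝ) : Prop :=
  ∃ C, ∀ m, ∀ t ∈ Icc (s m) (s m + L), |F m t| ≤ C

/-- The functions `F m` are uniformly Lipschitz on the windows `[s m, s m + L]`. -/
def WindowLip (s : ℕ → ℝ) (L : ℝ) (F : ℕ → ℝ → ℝ) : Prop :=
  ∃ M, 0 ≤ M ∧ ∀ m, ∀ t ∈ Icc (s m) (s m + L), ∀ t' ∈ Icc (s m) (s m + L),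
    |F m t - F m t'| ≤ M * |t - t'|

/-- Uniformly bounded and uniformly Lipschitz. -/
def WindowBL (s : ℕ → ℝ) (L : ℝ) (F : ℕ → ℝ → ℝ) : Prop := WindowBdd s L F ∧ WindowLip s L F

lemma WindowBdd.const (c : ℝ) : WindowBdd s L fun _ _ => c := ⟨|c|, fun _ _ _ => le_rfl⟩

lemma WindowBdd.add (hF : WindowBdd s L F) (hG : WindowBdd s L G) :
    WindowBdd s L fun m t => F m t + G m t := by
  obtain ⟨C, hC⟩ := hF
  obtain ⟨D, hD⟩ := hG
  exact ⟨C + D, fun m t ht => (abs_add_le _ _).trans (add_le_add (hC m t ht) (hD m t ht))⟩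

lemma WindowBdd.mul (hF : WindowBdd s L F) (hG : WindowBdd s L G) :
    WindowBdd s L fun m t => F m t * G m t := by
  obtain ⟨C, hC⟩ := hF
  obtain ⟨D, hD⟩ := hG
  refine ⟨C * D, fun m t ht => ?_⟩
  rw [abs_mul]
  exact mul_le_mul (hC m t ht) (hD m t ht) (abs_nonneg _) ((abs_nonneg _).trans (hC m t ht))

lemma WindowBdd.sum {ι : Type*} (I : Finset ι) {F : ι → ℕ → ℝ → ℝ}
    (hF : ∀ i ∈ I, WindowBdd s L (F i)) : WindowBdd s L fun m t => ∑ i ∈ I, F i m t := by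
  classical
  induction I using Finset.induction_on with
  | empty => simpa using WindowBdd.const (s := s) (L := L) 0
  | insert a I ha ih =>
    simp only [Finset.sum_insert ha]
    exact (hF a (Finset.mem_insert_self _ _)).add
      (ih fun i hi => hF i (Finset.mem_insert_of_mem hi))

lemma WindowBdd.abs (hF : WindowBdd s L F) : WindowBdd s L fun m t => |F m t| := by
  simpa only [WindowBdd, abs_abs] using hF

lemma WindowBdd.of_abs_le (hG : WindowBdd s L G)
    (h : ∀ m, ∀ t ∈ Icc (s m) (s m + L), |F m t| ≤ |G m t|) : WindowBdd s L F := by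
  obtain ⟨C, hC⟩ := hG
  exact ⟨C, fun m t ht => (h m t ht).trans (hC m t ht)⟩

lemma WindowBL.const (c : ℝ) : WindowBL s L fun _ _ => c :=
  ⟨.const c, 0, le_rfl, fun _ _ _ _ _ => by simp⟩

lemma WindowBL.mul (hF : WindowBL s L F) (hG : WindowBL s L G) :
    WindowBL s L fun m t => F m t * G m t := by
  refine ⟨hF.1.mul hG.1, ?_⟩
  obtain ⟨⟨C, hC⟩, M, hM0, hM⟩ := hF
  obtain ⟨⟨D, hD⟩, K, hK0, hK⟩ := hG
  refine ⟨|C| * K + |D| * M, by positivity, fun m t ht t' ht' => ?_⟩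
  have h1 : F m t * G m t - F m t' * G m t' =
      F m t * (G m t - G m t') + G m t' * (F m t - F m t') := by ring
  rw [h1]
  calc _ ≤ |F m t| * |G m t - G m t'| + |G m t'| * |F m t - F m t'| := by
        rw [← abs_mul, ← abs_mul]
        exact abs_add_le _ _
    _ ≤ |C| * (K * |t - t'|) + |D| * (M * |t - t'|) := add_le_add
        (mul_le_mul ((hC m t ht).trans (le_abs_self _)) (hK m t ht t' ht') (abs_nonneg _)
          (abs_nonneg _))
        (mul_le_mul ((hD m t' ht').trans (le_abs_self _)) (hM m t ht t' ht') (abs_nonneg _)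
          (abs_nonneg _))
    _ = _ := by ring

lemma WindowBL.of_hasDerivWithinAt (hF : WindowBdd s L F) {F' : ℕ → ℝ → ℝ}
    (hd : ∀ m, ∀ t ∈ Icc (s m) (s m + L),
      HasDerivWithinAt (F m) (F' m t) (Icc (s m) (s m + L)) t)
    (hF' : WindowBdd s L F') : WindowBL s L F := by
  refine ⟨hF, ?_⟩
  obtain ⟨C, hC⟩ := hF'
  refine ⟨|C|, abs_nonneg _, fun m t ht t' ht' => ?_⟩
  exact (convex_Icc _ _).norm_image_sub_le_of_norm_hasDerivWithin_le (hd m)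
    (fun r hr => (hC m r hr).trans (le_abs_self _)) ht' ht

lemma Vanishes.add (hF : Vanishes s L F) (hG : Vanishes s L G) :
    Vanishes s L fun m t => F m t + G m t := by
  intro ε hε
  filter_upwards [hF (ε / 2) (by positivity), hG (ε / 2) (by positivity)] with m h1 h2 t ht
  linarith [abs_add_le (F m t) (G m t), h1 t ht, h2 t ht]

lemma Vanishes.of_abs_le (hG : Vanishes s L G)
    (h : ∀ m, ∀ t ∈ Icc (s m) (s m + L), |F m t| ≤ |G m t|) : Vanishes s L F := fun ε hε => by
  filter_upwards [hG ε hε] with m h1 t ht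
  exact (h m t ht).trans (h1 t ht)

lemma Vanishes.zero : Vanishes s L fun _ _ => 0 := fun ε hε =>
  Eventually.of_forall fun _ _ _ => by simpa using hε.le

lemma Vanishes.bdd_mul (hG : WindowBdd s L G) (hF : Vanishes s L F) :
    Vanishes s L fun m t => G m t * F m t := by
  obtain ⟨C, hC⟩ := hG
  intro ε hε
  filter_upwards [hF (ε / (|C| + 1)) (by positivity)] with m h1 t ht
  rw [abs_mul]
  calc _ ≤ (|C| + 1) * (ε / (|C| + 1)) :=
        mul_le_mul (by linarith [hC m t ht, le_abs_self C]) (h1 t ht) (abs_nonneg _) (by positivity)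
    _ = ε := by field_simp

lemma Vanishes.const_mul (c : ℝ) (hF : Vanishes s L F) : Vanishes s L fun m t => c * F m t :=
  hF.bdd_mul (.const c)

lemma Vanishes.abs (hF : Vanishes s L F) : Vanishes s L fun m t => |F m t| := by
  simpa only [Vanishes, abs_abs] using hF

lemma Vanishes.sum {ι : Type*} (I : Finset ι) {F : ι → ℕ → ℝ → ℝ}
    (hF : ∀ i ∈ I, Vanishes s L (F i)) : Vanishes s L fun m t => ∑ i ∈ I, F i m t := by
  classical
  induction I using Finset.induction_on with
  | empty => simpa using Vanishes.zero
  | insert a I ha ih =>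
    simp only [Finset.sum_insert ha]
    exact (hF a (Finset.mem_insert_self _ _)).add
      (ih fun i hi => hF i (Finset.mem_insert_of_mem hi))

lemma Vanishes.of_pow {n : ℕ} (hn : n ≠ 0) (hF : Vanishes s L fun m t => F m t ^ n) :
    Vanishes s L F := fun ε hε => by
  filter_upwards [hF (ε ^ n) (by positivity)] with m h1 t ht
  have := h1 t ht
  rw [abs_pow] at this
  exact le_of_pow_le_pow_left₀ hn hε.le this

/-- If `F m` vanishes and its derivative is the sum of a uniformly Lipschitz function and of a
vanishing one, then the Lipschitz part vanishes as well. -/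
theorem Vanishes.of_hasDerivWithinAt (hL : 0 < L) {E : ℕ → ℝ → ℝ} (hF : Vanishes s L F)
    (hE : Vanishes s L E) (hG : WindowLip s L G)
    (hd : ∀ m, ∀ t ∈ Icc (s m) (s m + L),
      HasDerivWithinAt (F m) (G m t + E m t) (Icc (s m) (s m + L)) t) : Vanishes s L G := by
  obtain ⟨M, hM0, hM⟩ := hG
  intro ε hε
  -- On intervals of length τ, `G` varies by at most ε/4. The mean slope of `F` there is at most
  -- 2(ετ/8)/τ = ε/4, and `E` costs another ε/4.
  set τ := min L (ε / (4 * (M + 1))) with hτ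
  have hτ0 : 0 < τ := lt_min hL (by positivity)
  have hMτ : M * τ ≤ ε / 4 := by
    calc M * τ ≤ (M + 1) * (ε / (4 * (M + 1))) :=
          mul_le_mul (by linarith) (min_le_right _ _) hτ0.le (by positivity)
      _ = ε / 4 := by field_simp
  filter_upwards [hF (ε * τ / 8) (by positivity), hE (ε / 4) (by positivity)] with m h1 h2 t ht
  -- An interval of length τ around `t` inside the window, pushed left when `t` is near the right
  -- end.
  obtain ⟨a, ha1, ha2, ha3, ha4⟩ : ∃ a, s m ≤ a ∧ a + τ ≤ s m + L ∧ a ≤ t ∧ t ≤ a + τ := by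
    have hτL : τ ≤ L := min_le_left _ _
    rcases le_total t (s m + L - τ) with h | h
    · exact ⟨t, ht.1, by linarith, le_rfl, by linarith⟩
    · exact ⟨s m + L - τ, by linarith, by linarith, h, by linarith [ht.2]⟩
  have hsub : Icc a (a + τ) ⊆ Icc (s m) (s m + L) := Icc_subset_Icc ha1 ha2
  obtain ⟨r, hr, hr'⟩ := exists_hasDerivAt_eq_slope (F m) (fun t => G m t + E m t)
    (show a < a + τ by linarith)
    (fun t h => ((hd m t (hsub h)).continuousWithinAt).mono hsub)
    (fun t h => ((hd m t (hsub (Ioo_subset_Icc_self h))).mono hsub).hasDerivAt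
      (Icc_mem_nhds h.1 h.2))
  have hrW := hsub (Ioo_subset_Icc_self hr)
  have h3 : |G m r + E m r| ≤ ε / 4 := by
    have h4 := h1 a (hsub ⟨le_rfl, by linarith⟩)
    have h5 := h1 (a + τ) (hsub ⟨by linarith, le_rfl⟩)
    rw [hr', add_sub_cancel_left, abs_div, abs_of_pos hτ0, div_le_iff₀ hτ0]
    linarith [abs_sub (F m (a + τ)) (F m a)]
  have h6 : |G m t - G m r| ≤ ε / 4 := by
    refine (hM m t ht r hrW).trans (le_trans ?_ hMτ)
    refine mul_le_mul_of_nonneg_left ?_ hM0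
    rw [abs_le]
    constructor <;> linarith [hr.1, hr.2]
  have h7 := h2 r hrW
  rw [abs_le] at h3 h6 h7 ⊢
  constructor <;> linarith [h3.1, h3.2, h6.1, h6.2, h7.1, h7.2]

end Windows

/-! ### Trajectories on windows with vanishing Lyapunov decrease -/

section TrajectorySequence

variable {p : ℕ} {k : ℕ → ℝ} {H : ℝ → Vec (p + 1) → ℝ} {N : ℝ → ℝ}

/-- A sequence of trajectories on the windows `[s m, s m + L]`, bounded by `R`. -/
structure BoundedTrajectories (k : ℕ → ℝ) (H : ℝ → Vec (p + 1) → ℝ) (s : ℕ → ℝ) (L R : ℝ)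
    (X : ℕ → ℝ → Vec (p + 2)) : Prop where
  curve : ∀ m, IsIntegralCurveOn (X m) (skewField k H) (Icc (s m) (s m + L))
  bound : ∀ m, ∀ t ∈ Icc (s m) (s m + L), ‖X m t‖ ≤ R

namespace BoundedTrajectories

variable {s : ℕ → ℝ} {L R : ℝ} {X : ℕ → ℝ → Vec (p + 2)}

lemma deriv_smul (hX : BoundedTrajectories k H s L R X) (m : ℕ) {t : ℝ}
    (ht : t ∈ Icc (s m) (s m + L)) :
    HasDerivWithinAt (X m) ((1 : ℝ) • skewField k H t (X m t)) (Icc (s m) (s m + L)) t := by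
  simpa using hX.curve m t ht

lemma norm_tail_le (hX : BoundedTrajectories k H s L R X) (m : ℕ) {t : ℝ}
    (ht : t ∈ Icc (s m) (s m + L)) : ‖tail (X m t)‖ ≤ R :=
  (ChainedForm.norm_tail_le _).trans (hX.bound m t ht)

lemma bdd_coord (hX : BoundedTrajectories k H s L R X) (j : ℕ) :
    WindowBdd s L fun m t => coord (tail (X m t)) j :=
  ⟨R, fun m _ ht => (abs_coord_le _ _).trans (hX.norm_tail_le m ht)⟩

lemma bdd_control (hX : BoundedTrajectories k H s L R X) (hH : TameInput H N) :
    WindowBdd s L fun m t => controlU (k 1) H t (X m t) := by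
  have h1 : WindowBdd s L fun m t => X m t 0 :=
    ⟨R, fun m t ht => (PiLp.norm_apply_le (X m t) 0).trans (hX.bound m t ht)⟩
  have h2 : WindowBdd s L fun m t => H t (tail (X m t)) :=
    ⟨_, fun m t ht => hH.abs_le t (hX.norm_tail_le m ht)⟩
  exact ((WindowBdd.const (-k 1)).mul h1).add h2

/-- Every velocity component is a fixed linear combination of products u x̄_i and of x̄_n, so
boundedness and vanishing pass to it at once. -/
lemma skewRate_eq (p : ℕ) (k : ℕ → ℝ) (j : ℕ) : ∃ a b c : ℝ, ∃ i : ℕ, ∀ u y,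
    skewRate p k u y j = a * (u * y i) + b * (u * y (j + 1)) + c * y p := by
  rcases j with _ | j
  -- The first row has no subdiagonal entry: coefficient 0, with a dummy index.
  · refine ⟨0, 1, -if 0 = p then k (p + 2) else 0, 0, fun u y => ?_⟩
    simp only [skewRate, skewDrift]
    split_ifs <;> ring
  · refine ⟨-k (j + 2), 1, -if j + 1 = p then k (p + 2) else 0, j, fun u y => ?_⟩
    simp only [skewRate, skewDrift]
    split_ifs <;> ring

lemma bdd_skewRate (hX : BoundedTrajectories k H s L R X) (hH : TameInput H N) (j : ℕ) :
    WindowBdd s L fun m t =>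
      skewRate p k (controlU (k 1) H t (X m t)) (coord (tail (X m t))) j := by
  obtain ⟨a, b, c, i, h⟩ := skewRate_eq p k j
  simp only [h]
  exact (((WindowBdd.const a).mul ((hX.bdd_control hH).mul (hX.bdd_coord i))).add
    ((WindowBdd.const b).mul ((hX.bdd_control hH).mul (hX.bdd_coord (j + 1))))).add
    ((WindowBdd.const c).mul (hX.bdd_coord p))

lemma deriv_coord (hX : BoundedTrajectories k H s L R X) {j : ℕ} (hj : j ≤ p) (m : ℕ) {t : ℝ}
    (ht : t ∈ Icc (s m) (s m + L)) :
    HasDerivWithinAt (fun t => coord (tail (X m t)) j)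
      (skewRate p k (controlU (k 1) H t (X m t)) (coord (tail (X m t))) j)
      (Icc (s m) (s m + L)) t := by
  simpa using hasDerivWithinAt_coord_tail (hX.deriv_smul m ht) hj

lemma bl_coord (hX : BoundedTrajectories k H s L R X) (hH : TameInput H N) {j : ℕ} (hj : j ≤ p) :
    WindowBL s L fun m t => coord (tail (X m t)) j :=
  .of_hasDerivWithinAt (hX.bdd_coord j) (fun m _ ht => hX.deriv_coord hj m ht)
    (hX.bdd_skewRate hH j)

/-- The velocity of `x̄`. -/
def velocity (k : ℕ → ℝ) (H : ℝ → Vec (p + 1) → ℝ) (t : ℝ) (X : Vec (p + 2)) : Vec (p + 1) :=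
  tail (skewField k H t X)

lemma norm_velocity_le (t : ℝ) (X : Vec (p + 2)) : ‖velocity k H t X‖ ≤
    ∑ j ∈ Finset.range (p + 1), |skewRate p k (controlU (k 1) H t X) (coord (tail X)) j| := by
  refine (norm_le_sum_abs_coord _).trans (le_of_eq (Finset.sum_congr rfl fun j hj => ?_))
  have hj' := Finset.mem_range.1 hj
  rw [coord, dif_pos hj']
  change |(skewA p k (controlU (k 1) H t X)).mulVec (tail X).ofLp ⟨j, hj'⟩| = _
  rw [skewA_mulVec]
  rfl

lemma bdd_norm_velocity (hX : BoundedTrajectories k H s L R X) (hH : TameInput H N) :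
    WindowBdd s L fun m t => ‖velocity k H t (X m t)‖ := by
  refine (WindowBdd.sum (Finset.range (p + 1)) fun j _ => (hX.bdd_skewRate hH j).abs).of_abs_le
    fun m t _ => ?_
  rw [abs_norm]
  exact (norm_velocity_le t (X m t)).trans (le_abs_self _)

lemma deriv_tail (hX : BoundedTrajectories k H s L R X) (m : ℕ) {t : ℝ}
    (ht : t ∈ Icc (s m) (s m + L)) :
    HasDerivWithinAt (fun t => tail (X m t)) (velocity k H t (X m t)) (Icc (s m) (s m + L)) t := by
  have h1 : ∀ i : Fin (p + 1), HasDerivWithinAt (fun t => tail (X m t) i)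
      (velocity k H t (X m t) i) (Icc (s m) (s m + L)) t := fun i =>
    hasDerivWithinAt_apply (hX.curve m t ht) i.succ
  exact (PiLp.continuousLinearEquiv 2 ℝ fun _ : Fin (p + 1) => ℝ).symm.hasFDerivAt
    |>.comp_hasDerivWithinAt t (hasDerivWithinAt_pi.2 h1)

lemma deriv_comp (hX : BoundedTrajectories k H s L R X) {Φ : ℝ × Vec (p + 1) → ℝ}
    (hΦ : Differentiable ℝ Φ) (m : ℕ) {t : ℝ} (ht : t ∈ Icc (s m) (s m + L)) :
    HasDerivWithinAt (fun t => Φ (t, tail (X m t)))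
      (fderiv ℝ Φ (t, tail (X m t)) (1, velocity k H t (X m t))) (Icc (s m) (s m + L)) t :=
  (hΦ (t, tail (X m t))).hasFDerivAt.comp_hasDerivWithinAt t
    ((hasDerivWithinAt_id t _).prodMk (hX.deriv_tail m ht))

/-- The part of the derivative of `h` along a trajectory that is due to the velocity of `x̄`. -/
def spatialRate (k : ℕ → ℝ) (H : ℝ → Vec (p + 1) → ℝ) (t : ℝ) (X : Vec (p + 2)) : ℝ :=
  fderiv ℝ (Function.uncurry H) (t, tail X) (0, velocity k H t X)

lemma abs_spatialRate_le (hX : BoundedTrajectories k H s L R X) (hH : TameInput H N) (m : ℕ) {t : ℝ}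
    (ht : t ∈ Icc (s m) (s m + L)) :
    |spatialRate k H t (X m t)| ≤ N R * ‖velocity k H t (X m t)‖ := by
  refine ContinuousLinearMap.le_of_opNorm_le_of_le
    (fderiv ℝ (Function.uncurry H) (t, tail (X m t))) ?_ ?_
  · exact (hH.bound _ _).trans (hH.mono (hX.norm_tail_le m ht))
  · simp

lemma bdd_spatialRate (hX : BoundedTrajectories k H s L R X) (hH : TameInput H N) :
    WindowBdd s L fun m t => spatialRate k H t (X m t) :=
  ((WindowBdd.const (N R)).mul (hX.bdd_norm_velocity hH)).of_abs_le fun m _ ht =>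
    (hX.abs_spatialRate_le hH m ht).trans (le_abs_self _)

/-- Since x_1' = u, the control itself obeys a filter equation. The grouping isolates ∂h/∂t as the
Lipschitz part for `Vanishes.of_hasDerivWithinAt`. -/
lemma deriv_control (hX : BoundedTrajectories k H s L R X) (hH : TameInput H N) (m : ℕ) {t : ℝ}
    (ht : t ∈ Icc (s m) (s m + L)) :
    HasDerivWithinAt (fun t => controlU (k 1) H t (X m t))
      (timeDeriv H (t, tail (X m t)) +
        (-k 1 * controlU (k 1) H t (X m t) + spatialRate k H t (X m t)))
      (Icc (s m) (s m + L)) t := by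
  have h1 : HasDerivWithinAt (fun t => X m t 0) (controlU (k 1) H t (X m t))
      (Icc (s m) (s m + L)) t := hasDerivWithinAt_apply (hX.curve m t ht) 0
  have h2 := hX.deriv_comp (hH.contDiff.differentiable (by norm_num)) m ht
  refine ((h1.const_mul (-k 1)).add h2).congr_deriv ?_
  have h3 : ((1 : ℝ), velocity k H t (X m t)) = (1, 0) + (0, velocity k H t (X m t)) := by simp
  rw [h3, map_add]
  simp only [timeDeriv, spatialRate]
  ring

lemma bdd_timeDeriv (hX : BoundedTrajectories k H s L R X) (hH : TameInput H N) :
    WindowBdd s L fun m t => timeDeriv H (t, tail (X m t)) := by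
  refine ⟨N R * 1, fun m t ht => ContinuousLinearMap.le_of_opNorm_le_of_le
    (fderiv ℝ (Function.uncurry H) (t, tail (X m t))) ?_ ?_⟩
  · exact (hH.bound _ _).trans (hH.mono (hX.norm_tail_le m ht))
  · simp

/-- The bound on the differential of ∂h/∂t and the bounded velocity of x̄ give the Lipschitz
property needed to deduce ∂h/∂t → 0 from u → 0. -/
lemma bl_timeDeriv (hX : BoundedTrajectories k H s L R X) (hH : TameInput H N) :
    WindowBL s L fun m t => timeDeriv H (t, tail (X m t)) := by
  refine .of_hasDerivWithinAt (hX.bdd_timeDeriv hH)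
    (fun m t ht => hX.deriv_comp (hH.contDiff_timeDeriv.differentiable (by norm_num)) m ht) ?_
  refine ((WindowBdd.const (N R)).mul
    ((WindowBdd.const 1).add (hX.bdd_norm_velocity hH))).of_abs_le fun m t ht => ?_
  refine (ContinuousLinearMap.le_of_opNorm_le_of_le
    (fderiv ℝ (timeDeriv H) (t, tail (X m t))) ?_ ?_).trans (le_abs_self _)
  · exact (hH.bound' _ _).trans (hH.mono (hX.norm_tail_le m ht))
  · rw [Prod.norm_def]
    refine max_le ?_ ?_
    · simp
    · simp

lemma bl_control (hX : BoundedTrajectories k H s L R X) (hH : TameInput H N) :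
    WindowBL s L fun m t => controlU (k 1) H t (X m t) :=
  .of_hasDerivWithinAt (hX.bdd_control hH) (fun _ _ ht => hX.deriv_control hH _ ht)
    ((hX.bdd_timeDeriv hH).add
      (((WindowBdd.const _).mul (hX.bdd_control hH)).add (hX.bdd_spatialRate hH)))

/-- If the decrease of the Lyapunov function over the windows tends to zero, so does `x̄_n`. -/
lemma vanishes_coord_last (hX : BoundedTrajectories k H s L R X) (hH : TameInput H N)
    (hk : ∀ i, 1 ≤ i → i ≤ p + 2 → 0 < k i) (hL : 0 < L)
    (hdrop : ∀ η > 0, ∀ᶠ m in atTop,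
      lyap p k (tail (X m (s m))) - lyap p k (tail (X m (s m + L))) ≤ η) :
    Vanishes s L fun m t => coord (tail (X m t)) p := by
  have hanti : ∀ m, AntitoneOn (fun t => lyap p k (tail (X m t))) (Icc (s m) (s m + L)) := fun m =>
    antitoneOn_lyap hk (convex_Icc _ _) (θ := fun _ => 1) (fun _ => zero_le_one)
      fun t ht => hX.deriv_smul m ht
  have h1 : Vanishes s L fun m t => lyap p k (tail (X m (s m))) - lyap p k (tail (X m t)) := by
    intro ε hε
    filter_upwards [hdrop ε hε] with m hm t ht
    have hl : s m ≤ s m + L := by linarith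
    have h2 := hanti m ⟨le_rfl, hl⟩ ht ht.1
    have h3 := hanti m ht ⟨hl, le_rfl⟩ ht.2
    simp only at h2 h3
    rw [abs_of_nonneg (by linarith)]
    linarith
  set c := 2 * k (p + 2) / lyapWeight k p with hc
  have hc0 : 0 < c := by
    have h2 := hk (p + 2) (by omega) le_rfl
    have h3 := lyapWeight_pos hk (le_refl p)
    positivity
  have hbl := hX.bl_coord hH (le_refl p)
  -- The accumulated decrease of V is small and its derivative is c x̄_n², which is uniformly
  -- Lipschitz.
  have h4 := Vanishes.of_hasDerivWithinAt hL h1 Vanishes.zero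
    ((WindowBL.const c).mul (hbl.mul hbl)).2 fun m t ht =>
      ((hasDerivWithinAt_lyap hk (hX.deriv_smul m ht)).const_sub _).congr_deriv (by
        simp only [← hc]; ring)
  refine Vanishes.of_pow two_ne_zero ((h4.const_mul c⁻¹).of_abs_le fun m t _ => le_of_eq ?_)
  congr 1
  field_simp

/-- If `x̄_n` vanishes, so do all products `u x̄_j`. -/
lemma vanishes_control_mul_coord (hX : BoundedTrajectories k H s L R X) (hH : TameInput H N)
    (hk : ∀ i, 1 ≤ i → i ≤ p + 2 → 0 < k i) (hL : 0 < L)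
    (hlast : Vanishes s L fun m t => coord (tail (X m t)) p) (j : ℕ) :
    Vanishes s L fun m t => controlU (k 1) H t (X m t) * coord (tail (X m t)) j := by
  have hu := hX.bl_control hH
  have hbig : ∀ j, p < j → Vanishes s L fun m t =>
      controlU (k 1) H t (X m t) * coord (tail (X m t)) j := fun j hj => by
    simpa only [coord_of_le _ hj, mul_zero] using Vanishes.zero
  -- Descending induction on `j`, carrying two consecutive indices because the field couples both
  -- neighbours; it starts from x̄_n and x̄_{n+1} = 0.
  have key : ∀ i j : ℕ, j + i = p →
      (Vanishes s L fun m t => controlU (k 1) H t (X m t) * coord (tail (X m t)) j) ∧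
      Vanishes s L fun m t => controlU (k 1) H t (X m t) * coord (tail (X m t)) (j + 1) := by
    intro i
    induction i with
    | zero =>
      rintro j rfl
      exact ⟨hlast.bdd_mul hu.1, hbig _ (by omega)⟩
    | succ i ih =>
      intro j hj
      obtain ⟨h1, h2⟩ := ih (j + 1) (by omega)
      refine ⟨?_, h1⟩
      have hbl := hX.bl_coord hH (show j ≤ p by omega)
      have hu3 := (WindowBL.const (-k (j + 2))).mul ((hu.mul (hu.mul hu)).mul hbl)
      have hu' : WindowBdd s L fun m t => timeDeriv H (t, tail (X m t)) +
          (-k 1 * controlU (k 1) H t (X m t) + spatialRate k H t (X m t)) :=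
        (hX.bdd_timeDeriv hH).add
          (((WindowBdd.const _).mul (hX.bdd_control hH)).add (hX.bdd_spatialRate hH))
      have hE := ((h1.bdd_mul hu').const_mul 2).add
        ((h2.bdd_mul (hu.1.mul hu.1)).add
          ((hlast.bdd_mul (hu.1.mul hu.1)).const_mul (-if j + 1 = p then k (p + 2) else 0)))
      -- Differentiate u² times coordinate `j + 1`. With a single factor u, the term containing u'
      -- would not be known to vanish; with u² it is 2u' times the already vanishing product. The
      -- part left over is −k_{j+2} u³ times coordinate `j`.
      have h3 := Vanishes.of_hasDerivWithinAt hL (h1.bdd_mul hu.1) hE hu3.2 fun m t ht => by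
        have hdu := hX.deriv_control hH m ht
        refine (hdu.mul (hdu.mul
          (hX.deriv_coord (show j + 1 ≤ p by omega) m ht))).congr_deriv ?_
        simp only [skewRate, skewDrift, Pi.mul_apply]
        split_ifs <;> ring
      have hkj := (hk (j + 2) (by omega) (by omega)).ne'
      -- Multiplying by the square of coordinate `j` produces the cube of the desired product.
      refine Vanishes.of_pow three_ne_zero
        (((h3.bdd_mul (hbl.1.mul hbl.1)).const_mul (-(k (j + 2))⁻¹)).of_abs_le
          fun m t _ => le_of_eq ?_)
      congr 1
      field_simp
  rcases le_or_gt j p with hj | hj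
  · exact (key (p - j) j (by omega)).1
  · exact hbig j hj

/-- If `x̄_n` vanishes while `x̄` stays away from zero, then the velocity of `x̄` and `∂h/∂t`
vanish. -/
theorem vanishes_velocity_and_timeDeriv (hX : BoundedTrajectories k H s L R X)
    (hH : TameInput H N) (hk : ∀ i, 1 ≤ i → i ≤ p + 2 → 0 < k i) (hL : 0 < L)
    (hlast : Vanishes s L fun m t => coord (tail (X m t)) p) {ε : ℝ} (hε : 0 < ε)
    (hfar : ∀ m, ∀ t ∈ Icc (s m) (s m + L), ε ≤ ‖tail (X m t)‖) :
    (Vanishes s L fun m t => ‖velocity k H t (X m t)‖) ∧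
      Vanishes s L fun m t => timeDeriv H (t, tail (X m t)) := by
  have huy := hX.vanishes_control_mul_coord hH hk hL hlast
  have hu := hX.bl_control hH
  have hu0 : Vanishes s L fun m t => controlU (k 1) H t (X m t) := by
    -- Summing the squared products gives u² |x̄|², and |x̄| ≥ ε allows division.
    have h1 := (Vanishes.sum (Finset.range (p + 1)) fun j _ =>
      (huy j).bdd_mul (hu.1.mul (hX.bdd_coord j))).const_mul (ε ^ 2)⁻¹
    refine Vanishes.of_pow two_ne_zero (h1.of_abs_le fun m t ht => ?_)
    have h2 : ∑ j ∈ Finset.range (p + 1),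
        controlU (k 1) H t (X m t) * coord (tail (X m t)) j *
          (controlU (k 1) H t (X m t) * coord (tail (X m t)) j) =
        controlU (k 1) H t (X m t) ^ 2 * ‖tail (X m t)‖ ^ 2 := by
      rw [norm_sq_eq_sum_coord, Finset.mul_sum]
      exact Finset.sum_congr rfl fun j _ => by ring
    have h3 : ε ^ 2 ≤ ‖tail (X m t)‖ ^ 2 := pow_le_pow_left₀ hε.le (hfar m t ht) 2
    rw [h2, abs_of_nonneg (sq_nonneg _), abs_of_nonneg (by positivity), inv_mul_eq_div,
      le_div_iff₀ (by positivity)]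
    exact mul_le_mul_of_nonneg_left h3 (sq_nonneg _)
  have hrate : ∀ j, Vanishes s L fun m t =>
      skewRate p k (controlU (k 1) H t (X m t)) (coord (tail (X m t))) j := fun j => by
    obtain ⟨a, b, c, i, h⟩ := skewRate_eq p k j
    simp only [h]
    exact (((huy i).const_mul a).add ((huy (j + 1)).const_mul b)).add (hlast.const_mul c)
  have hvel : Vanishes s L fun m t => ‖velocity k H t (X m t)‖ := by
    refine (Vanishes.sum (Finset.range (p + 1)) fun j _ => (hrate j).abs).of_abs_le
      fun m t _ => ?_
    rw [abs_norm]
    exact (norm_velocity_le t (X m t)).trans (le_abs_self _)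
  refine ⟨hvel, ?_⟩
  have hsp : Vanishes s L fun m t => spatialRate k H t (X m t) :=
    (hvel.const_mul (N R)).of_abs_le fun m t ht =>
      (hX.abs_spatialRate_le hH m ht).trans (le_abs_self _)
  exact Vanishes.of_hasDerivWithinAt hL hu0 ((hu0.const_mul (-k 1)).add hsp)
    (hX.bl_timeDeriv hH).2 fun m t ht => hX.deriv_control hH m ht

end BoundedTrajectories

end TrajectorySequence

/-! ### Uniformity of the excitation -/

section Excitation

variable {p : ℕ}

/-- Persistency of excitation is uniform on compact sets that avoid the origin. -/
lemma IsUDeltaPE.exists_uniform {E F : Type*} [NormedAddCommGroup E] [NormedSpace ℝ E]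
    [FiniteDimensional ℝ E] [NormedAddCommGroup F] {φ : ℝ → E → F} (hφ : IsUDeltaPE φ)
    {ε : ℝ} (hε : 0 < ε) (R : ℝ) :
    ∃ L > 0, ∃ μ > 0, ∀ ξ : E, ε ≤ ‖ξ‖ → ‖ξ‖ ≤ R → ∀ t, μ ≤ ∫ τ in t..(t + L), ‖φ τ ξ‖ := by
  obtain ⟨hint, hpe⟩ := hφ
  have hK : IsCompact ({ξ : E | ε ≤ ‖ξ‖} ∩ Metric.closedBall 0 R) :=
    (isCompact_closedBall (0 : E) R).inter_left (isClosed_le continuous_const continuous_norm)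
  -- Monotonicity in the length lets two pairs (L, μ) be merged. It rests on local integrability, as
  -- the integral of a non-integrable function is 0 by convention.
  have hlonger : ∀ (ξ : E) {L L' μ : ℝ}, 0 ≤ L → L ≤ L' → ∀ t,
      μ ≤ ∫ τ in t..(t + L), ‖φ τ ξ‖ → μ ≤ ∫ τ in t..(t + L'), ‖φ τ ξ‖ := by
    intro ξ L L' μ hL hLL' t h
    refine h.trans (intervalIntegral.integral_mono_interval le_rfl (by linarith) (by linarith)
      (Eventually.of_forall fun _ => norm_nonneg _) ?_)
    exact ((hint ξ).integrableOn_isCompact isCompact_uIcc).intervalIntegrable.norm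
  have key : ∃ L > 0, ∃ μ > 0, ∀ ξ ∈ {ξ : E | ε ≤ ‖ξ‖} ∩ Metric.closedBall 0 R,
      ∀ t, μ ≤ ∫ τ in t..(t + L), ‖φ τ ξ‖ := by
    refine hK.induction_on (p := fun S => ∃ L > 0, ∃ μ > 0, ∀ ξ ∈ S,
      ∀ t, μ ≤ ∫ τ in t..(t + L), ‖φ τ ξ‖) ?_ ?_ ?_ ?_
    · exact ⟨1, one_pos, 1, one_pos, by simp⟩
    · rintro S S' hSS' ⟨L, hL, μ, hμ, h⟩
      exact ⟨L, hL, μ, hμ, fun ξ hξ => h ξ (hSS' hξ)⟩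
    · rintro S S' ⟨L, hL, μ, hμ, h⟩ ⟨L', hL', μ', hμ', h'⟩
      refine ⟨max L L', lt_max_of_lt_left hL, min μ μ', lt_min hμ hμ', ?_⟩
      rintro ξ (hξ | hξ) t
      · exact hlonger ξ hL.le (le_max_left _ _) t ((min_le_left _ _).trans (h ξ hξ t))
      · exact hlonger ξ hL'.le (le_max_right _ _) t ((min_le_right _ _).trans (h' ξ hξ t))
    · rintro ξ ⟨hξ, -⟩
      have hξ0 : ξ ≠ 0 := norm_pos_iff.1 (hε.trans_le hξ)
      obtain ⟨δ, hδ, T, hT, μ, hμ, h⟩ := hpe ξ hξ0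
      refine ⟨Metric.closedBall ξ δ, mem_nhdsWithin_of_mem_nhds (Metric.closedBall_mem_nhds ξ hδ),
        T, hT, μ, hμ, fun η hη t => h t η ?_⟩
      simpa [dist_eq_norm] using hη
  obtain ⟨L, hL, μ, hμ, h⟩ := key
  exact ⟨L, hL, μ, hμ, fun ξ h1 h2 t => h ξ ⟨h1, by simpa using h2⟩ t⟩

/-- `(x̄_2, …, x̄_{n-1})`. -/
def initVec (y : Vec (p + 1)) : Vec p := WithLp.toLp 2 fun i => y i.castSucc

lemma norm_extendZero (ξ : Vec p) : ‖extendZero ξ‖ = ‖ξ‖ := by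
  refine (sq_eq_sq₀ (norm_nonneg _) (norm_nonneg _)).1 ?_
  rw [EuclideanSpace.norm_sq_eq, EuclideanSpace.norm_sq_eq, Fin.sum_univ_castSucc]
  simp [extendZero]

/-- Replacing x̄ by (ξ, 0) costs exactly |x̄_n|, which vanishes on the windows. -/
lemma norm_extendZero_initVec_sub (y : Vec (p + 1)) :
    ‖extendZero (initVec y) - y‖ = |coord y p| := by
  refine (sq_eq_sq₀ (norm_nonneg _) (abs_nonneg _)).1 ?_
  rw [EuclideanSpace.norm_sq_eq, Fin.sum_univ_castSucc]
  have h1 : coord y p = y (Fin.last p) := coord_fin y (Fin.last p)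
  simp [extendZero, initVec, h1]

lemma norm_initVec_le (y : Vec (p + 1)) : ‖initVec y‖ ≤ ‖y‖ := by
  refine le_of_sq_le_sq ?_ (norm_nonneg _)
  rw [EuclideanSpace.norm_sq_eq, EuclideanSpace.norm_sq_eq y, Fin.sum_univ_castSucc]
  exact le_add_of_nonneg_right (sq_nonneg ‖y (Fin.last p)‖)

end Excitation

/-! ### Uniform attractivity -/

section Attractivity

variable {p : ℕ} {k : ℕ → ℝ} {H : ℝ → Vec (p + 1) → ℝ} {N : ℝ → ℝ}

/-- No sequence of bounded trajectories with `x̄` away from zero has a Lyapunov decrease tending to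
zero over windows long enough for the excitation to act. -/
lemma BoundedTrajectories.not_persistent {s : ℕ → ℝ} {L R : ℝ} {X : ℕ → ℝ → Vec (p + 2)}
    (hX : BoundedTrajectories k H s L R X) (hH : TameInput H N)
    (hk : ∀ i, 1 ≤ i → i ≤ p + 2 → 0 < k i) (hL : 0 < L)
    (hdrop : ∀ η > 0, ∀ᶠ m in atTop,
      lyap p k (tail (X m (s m))) - lyap p k (tail (X m (s m + L))) ≤ η)
    {ε : ℝ} (hε : 0 < ε) (hfar : ∀ m, ∀ t ∈ Icc (s m) (s m + L), ε ≤ ‖tail (X m t)‖)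
    {μ : ℝ} (hμ : 0 < μ)
    (hpe : ∀ ξ : Vec p, ε / 2 ≤ ‖ξ‖ → ‖ξ‖ ≤ R → ∀ t,
      μ ≤ ∫ τ in t..(t + L), ‖timeDeriv H (τ, extendZero ξ)‖) : False := by
  have hlast := hX.vanishes_coord_last hH hk hL hdrop
  obtain ⟨hvel, htd⟩ := hX.vanishes_velocity_and_timeDeriv hH hk hL hlast hε hfar
  have hNR := hH.nonneg R
  -- Chosen so that the final bound on the excitation integral is μ/2.
  set e := μ / (2 * (L * (1 + N R * (1 + L)))) with he
  have he0 : 0 < e := by positivity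
  obtain ⟨m, h1, h2, h3, h4⟩ := ((hlast e he0).and ((hvel e he0).and
    ((htd e he0).and (hlast (ε / 2) (by positivity))))).exists
  have hs : s m ∈ Icc (s m) (s m + L) := ⟨le_rfl, by linarith⟩
  set ξ := initVec (tail (X m (s m))) with hξ
  have hξR : ‖ξ‖ ≤ R := (norm_initVec_le _).trans (hX.norm_tail_le m hs)
  have hξε : ε / 2 ≤ ‖ξ‖ := by
    have h5 := norm_sub_norm_le (tail (X m (s m))) (extendZero ξ)
    rw [norm_sub_rev, norm_extendZero_initVec_sub, norm_extendZero] at h5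
    linarith [h4 _ hs, hfar m _ hs]
  -- Freezing x̄ at the start of the window costs `e` for the last coordinate and `e * L` for the
  -- drift, times the Lipschitz constant `N R`.
  have hbound : ∀ τ ∈ Icc (s m) (s m + L),
      ‖timeDeriv H (τ, extendZero ξ)‖ ≤ e * (1 + N R * (1 + L)) := by
    intro τ hτ
    have h5 : ‖tail (X m τ) - tail (X m (s m))‖ ≤ e * L := by
      have h6 := (convex_Icc (s m) (s m + L)).norm_image_sub_le_of_norm_hasDerivWithin_le
        (fun t ht => hX.deriv_tail m ht)
        (fun t ht => by simpa using h2 t ht) hs hτ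
      refine h6.trans (mul_le_mul_of_nonneg_left ?_ he0.le)
      rw [Real.norm_eq_abs, abs_of_nonneg (by linarith [hτ.1])]
      linarith [hτ.2]
    have h7 : ‖extendZero ξ - tail (X m τ)‖ ≤ e + e * L := by
      have h8 : extendZero ξ - tail (X m τ) = (extendZero ξ - tail (X m (s m))) -
          (tail (X m τ) - tail (X m (s m))) := by abel
      rw [h8]
      refine (norm_sub_le _ _).trans (add_le_add ?_ h5)
      rw [norm_extendZero_initVec_sub]
      exact h1 _ hs
    have h9 := hH.abs_timeDeriv_sub_le τ (y := extendZero ξ) (w := tail (X m τ)) (r := R)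
      (by rwa [norm_extendZero]) (hX.norm_tail_le m hτ)
    have h10 := h9.trans (mul_le_mul_of_nonneg_left h7 hNR)
    have h11 := h3 τ hτ
    rw [Real.norm_eq_abs]
    have h12 := abs_sub_abs_le_abs_sub (timeDeriv H (τ, extendZero ξ))
      (timeDeriv H (τ, tail (X m τ)))
    linarith
  have h13 := hpe ξ hξε hξR (s m)
  have h14 := intervalIntegral.norm_integral_le_of_norm_le_const (a := s m) (b := s m + L)
    (f := fun τ => ‖timeDeriv H (τ, extendZero ξ)‖) (C := e * (1 + N R * (1 + L)))
    fun τ hτ => by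
      rw [uIoc_of_le hs.2] at hτ
      rw [norm_norm]
      exact hbound τ (Ioc_subset_Icc_self hτ)
  rw [add_sub_cancel_left, abs_of_pos hL] at h14
  have h15 := (le_abs_self _).trans h14
  have h16 : e * (1 + N R * (1 + L)) * L = μ / 2 := by
    rw [he]
    field_simp
  linarith

/-- Along trajectories from a bounded set `x̄` becomes small within a uniform time. -/
lemma exists_time_norm_tail_lt (hH : TameInput H N) (hk : ∀ i, 1 ≤ i → i ≤ p + 2 → 0 < k i)
    (hpe : IsUDeltaPE fun t (ξ : Vec p) => timeDeriv H (t, extendZero ξ)) {R ε : ℝ} (hε : 0 < ε) :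
    ∃ T, 0 ≤ T ∧ ∀ (t₀ : ℝ) (X : ℝ → Vec (p + 2)), IsIntegralCurveOn X (skewField k H) (Ici t₀) →
      (∀ t, t₀ ≤ t → ‖X t‖ ≤ R) → ∃ t ∈ Icc t₀ (t₀ + T), ‖tail (X t)‖ < ε := by
  obtain ⟨L, hL, μ, hμ, hpe'⟩ := hpe.exists_uniform (half_pos hε) R
  by_contra! hcon
  -- The `m`-th counterexample lasts `(m + 1) * L`, that is `m + 1` windows. The total decrease of V
  -- is at most `c * R ^ 2`, so some window has decrease at most `c * R ^ 2 / (m + 1)`.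
  choose t₀ X hcurve hbound hfar using fun m : ℕ =>
    hcon (((m : ℝ) + 1) * L) (by positivity)
  obtain ⟨c, hc, hc1, -⟩ := exists_lyap_bounds hk
  have hR : 0 ≤ R := (norm_nonneg _).trans (hbound 0 _ le_rfl)
  have hpig : ∀ m : ℕ, ∃ i < m + 1, lyap p k (tail (X m (t₀ m + i * L))) -
      lyap p k (tail (X m (t₀ m + i * L + L))) ≤ c * R ^ 2 / ((m : ℝ) + 1) := by
    intro m
    set v : ℕ → ℝ := fun i => lyap p k (tail (X m (t₀ m + i * L))) with hv
    have h1 : ∑ i ∈ Finset.range (m + 1), (v i - v (i + 1)) ≤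
        ∑ i ∈ Finset.range (m + 1), c * R ^ 2 / ((m : ℝ) + 1) := by
      rw [Finset.sum_range_sub', Finset.sum_const, Finset.card_range, nsmul_eq_mul]
      push_cast
      rw [mul_div_cancel₀ _ (by positivity)]
      have h2 : v 0 ≤ c * R ^ 2 := by
        refine (hc1 _).trans (mul_le_mul_of_nonneg_left (pow_le_pow_left₀ (norm_nonneg _) ?_ 2) hc.le)
        exact (norm_tail_le _).trans (hbound m _ (by simp))
      have h3 : 0 ≤ v (m + 1) := lyap_nonneg hk _
      linarith
    obtain ⟨i, hi, h2⟩ := Finset.exists_le_of_sum_le (by simp) h1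
    refine ⟨i, Finset.mem_range.1 hi, ?_⟩
    have h3 : t₀ m + i * L + L = t₀ m + ((i + 1 : ℕ) : ℝ) * L := by push_cast; ring
    rw [h3]
    exact h2
  choose i hi hdrop using hpig
  have hsub : ∀ m, Icc (t₀ m + i m * L) (t₀ m + i m * L + L) ⊆
      Icc (t₀ m) (t₀ m + ((m : ℝ) + 1) * L) := fun m => by
    refine Icc_subset_Icc (by simp; positivity) ?_
    have h1 : (i m : ℝ) + 1 ≤ (m : ℝ) + 1 := by exact_mod_cast hi m
    nlinarith
  have hT : BoundedTrajectories k H (fun m => t₀ m + i m * L) L R X :=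
    { curve := fun m => (hcurve m).mono fun t ht => (hsub m ht).1
      bound := fun m t ht => hbound m t (hsub m ht).1 }
  refine hT.not_persistent hH hk hL (fun η hη => ?_) hε
    (fun m t ht => hfar m t (hsub m ht)) hμ hpe'
  have h1 : Tendsto (fun m : ℕ => c * R ^ 2 / ((m : ℝ) + 1)) atTop (𝓝 0) :=
    ((tendsto_const_div_atTop_nhds_zero_nat (c * R ^ 2)).comp (tendsto_add_atTop_nat 1)).congr
      fun m => by simp
  filter_upwards [h1.eventually_le_const hη] with m hm
  exact (hdrop m).trans hm

theorem isUGA_skewField (hH : TameInput H N) (hk : ∀ i, 1 ≤ i → i ≤ p + 2 → 0 < k i)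
    (hpe : IsUDeltaPE fun t (ξ : Vec p) => timeDeriv H (t, extendZero ξ)) :
    IsUGA (skewField k H) := by
  intro r hr σ hσ
  obtain ⟨γ, hγ, hγ'⟩ := isUGS_skewField hk hH
  obtain ⟨c, hc, hc'⟩ := exists_norm_tail_le p hk
  have hk1 := hk 1 le_rfl (by omega)
  have hN := hH.nonneg c
  set R := γ r with hR
  have hR0 : 0 ≤ R := by
    rw [hR, ← hγ.2.2.1]
    exact hγ.2.1.monotoneOn (mem_Ici.2 le_rfl) (mem_Ici.2 hr.le) hr.le
  -- Once |x̄| < ε, the later bounds cε on x̄ and N(c)cε/k_1 on the forced part of x_1 add up to `D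
  -- * ε`. Taking ε ≤ 1 gives N(cε) ≤ N(c).
  set D := c + N c * c / k 1 with hD
  have hD0 : 0 < D := by positivity
  set ε := min 1 (σ / (2 * D)) with hε
  have hε0 : 0 < ε := lt_min one_pos (by positivity)
  have hDε : D * ε ≤ σ / 2 :=
    (mul_le_mul_of_nonneg_left (min_le_right _ _) hD0.le).trans (le_of_eq (by field_simp))
  obtain ⟨T, hT, hT'⟩ := exists_time_norm_tail_lt hH hk hpe (R := R) hε0
  -- Transient of x_1: exp(k_1 T₂) ≥ k_1 T₂ = 2R/σ brings the initial value below σ/2.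
  set T₂ := 2 * R / σ / k 1 with hT₂
  have hT₂0 : 0 ≤ T₂ := by positivity
  refine ⟨T + T₂ + 1, by positivity, fun t₀ X hX hXr t ht => ?_⟩
  have hb : ∀ t, t₀ ≤ t → ‖X t‖ ≤ R := fun t ht => (hγ' t₀ X hX t ht).trans
    (hγ.2.1.monotoneOn (mem_Ici.2 (norm_nonneg _)) (mem_Ici.2 hr.le) hXr)
  obtain ⟨t₁, ht₁, hlt⟩ := hT' t₀ X hX hb
  have ht₁t : t₁ + T₂ ≤ t := by linarith [ht₁.2]
  have hX1 : ∀ t ∈ Ici t₀, HasDerivWithinAt X ((1 : ℝ) • skewField k H t (X t)) (Ici t₀) t :=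
    fun t ht => by simpa using hX t ht
  have hy : ∀ τ, t₁ ≤ τ → ‖tail (X τ)‖ ≤ c * ε := fun τ hτ =>
    (hc' H X (Ici t₀) (convex_Ici t₀) (fun _ => 1) (fun _ => zero_le_one) hX1 t₁ ht₁.1 τ
      (mem_Ici.2 (ht₁.1.trans hτ)) hτ).trans (mul_le_mul_of_nonneg_left hlt.le hc.le)
  have hNε : N (c * ε) ≤ N c := hH.mono (mul_le_of_le_one_right hc.le (min_le_left _ _))
  have hle : t₁ ≤ t := by linarith
  have hsub : Icc t₁ t ⊆ Ici t₀ := fun τ hτ => ht₁.1.trans hτ.1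
  have h1 := abs_le_of_stable_scalar (a := fun t => X t 0) (b := fun t => H t (tail (X t)))
    (θ := fun _ => 1) (Θ := fun t => t) (β := N c * (c * ε)) hk1 hle
    (fun τ hτ => (hasDerivWithinAt_zero_component (hX1 τ (hsub hτ))).mono hsub)
    (fun τ _ => hasDerivWithinAt_id τ _) (fun _ => zero_le_one)
    (fun τ hτ => (hH.abs_le τ (hy τ hτ.1)).trans
      (mul_le_mul_of_nonneg_right hNε (by positivity)))
  have h2 : Real.exp (-k 1 * (t - t₁)) * |X t₁ 0| ≤ σ / 2 := by
    have h3 : |X t₁ 0| ≤ R := (PiLp.norm_apply_le (X t₁) 0).trans (hb t₁ ht₁.1)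
    have h4 : 2 * R / σ ≤ Real.exp (k 1 * (t - t₁)) := by
      have h5 : k 1 * T₂ ≤ k 1 * (t - t₁) := mul_le_mul_of_nonneg_left (by linarith) hk1.le
      have h6 : k 1 * T₂ = 2 * R / σ := by rw [hT₂]; field_simp
      linarith [Real.add_one_le_exp (k 1 * (t - t₁))]
    rw [neg_mul, Real.exp_neg, inv_mul_le_iff₀ (Real.exp_pos _)]
    rw [div_le_iff₀ hσ] at h4
    linarith
  have h7 := norm_le_abs_add_norm_tail (X t)
  have h8 := hy t hle
  have h9 : N c * (c * ε) / k 1 + c * ε = D * ε := by rw [hD]; ring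
  simp only at h1
  linarith

end Attractivity

end ChainedForm

end

/-! ### The main theorem -/

open ChainedForm in
theorem proposition2 (p : ℕ) (hp : 2 ≤ p)
    (k k' : ℕ → ℝ)
    (hk : ∀ i, 1 ≤ i → i ≤ p + 2 → 0 < k i)
    (hk' : ∀ i, 2 ≤ i → i ≤ p + 2 → 0 < k' i)
    (hkk' : GainsMatch p k' k)
    (h : ℝ → Vec (p + 1) → ℝ)
    (h_zero : ∀ t, h t 0 = 0)
    (h_bound : HasBoundedPartials h)
    (h_pe : IsUDeltaPE (excitation k h)) :
    (∀ (t : ℝ) (x : Vec (p + 2)),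
      skewCoord k (chainedClosedLoop (k 1) k' h t x) = skewClosedLoop k h t (skewCoord k x)) ∧
    IsUGAS (skewClosedLoop k h) := by
  obtain ⟨N, hN⟩ := exists_tameInput_skewH k h_zero h_bound
  have hφ : excitation k h = fun t (ξ : Vec p) => timeDeriv (skewH k h) (t, extendZero ξ) :=
    funext fun t => funext fun ξ => deriv_eq_timeDeriv hN t (extendZero ξ)
  rw [hφ] at h_pe
  -- `skewClosedLoop k h` is by definition `skewField k (skewH k h)`, so the general results apply
  -- to it.
  exact ⟨skewCoord_chainedClosedLoop hkk' h, isForwardComplete_skewField hk hN,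
    isUGS_skewField hk hN, isUGA_skewField hN hk h_pe⟩
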